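/- **Setting.** Let $P_{\rm U},\sigma_{\rm D}^2,\ell_{\rm UR},\ell_{\rm RD},\ell_{\rm UD}>0$, $\kappa_{\rm R}\in(0,1]$, $\tau\ge 0$, Rician factors $K_{\rm UR},K_{\rm RD},K_{\rm UD}\ge0$, $N$ RIS elements, and finitely many aerial and ground interferers $X\in\{{\rm I}_1,\dots,{\rm I}_L,{\rm J}_1,\dots,{\rm J}_K\}$ with powers $P_X\ge0$, path losses $\ell_X>0$ and Rician factors $K_X\ge0$. All small-scale coefficients $h_{{\rm UR}_n},h_{{\rm R}_n{\rm D}},h_{\rm UD},h_{X{\rm D}}$ are independent and Rician: $h=(\sqrt{K}\,\check h+\tilde h)/\sqrt{K+1}$, $|\check h|=1$, $\tilde h\sim\mathcal{CN}(0,1)$, with the factor $K$ of the link (the same for all $n$). Put $\bar\gamma_{\rm cas}=P_{\rm U}\ell_{\rm UR}\ell_{\rm RD}\kappa_{\rm R}^2/\sigma_{\rm D}^2$, $\bar\gamma_{\rm dir}=P_{\rm U}\ell_{\rm UD}/\sigma_{\rm D}^2$, $\bar\gamma_X=P_X\ell_X/\sigma_{\rm D}^2$, $\lambda_{\rm UD}=(K_{\rm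 UD}+1)/\ell_{\rm UD}$, $\beta=\Pr(\ell_{\rm UD}|h_{\rm UD}|^2<\tau)$. The blockage process $(\phi_t)_{t\ge0}$ is a stationary Markov chain on $\{0,1\}$ with $p_{00}=p_{10}=\beta$, $p_{01}=p_{11}=1-\beta$ and steady state $\pi_0=p_{10}/(p_{01}+p_{10})$, $\pi_1=p_{01}/(p_{01}+p_{10})$, and $\phi_0=0$ (blocked) iff $\ell_{\rm UD}|h_{\rm UD}|^2<\tau$ (almost surely). Let $\gamma_{\rm cas}=\big(\sum_{n=1}^N|h_{{\rm UR}_n}||h_{{\rm R}_n{\rm D}}|\big)^2$, $\gamma_{\rm dir}=\phi_0|h_{\rm UD}|^2$, $\gamma=\gamma_{\rm dir}\bar\gamma_{\rm dir}/\bar\gamma_{\rm cas}$, $\gamma_{\rm a2g}=(\sqrt{\gamma_{\rm cas}}+\sqrt{\gamma})^2$, $W=1+\sum_X\bar\gamma_X|h_{X{\rm D}}|^2$; the A2G SINR is $\Gamma^\star_{\rm a2g}=(\sqrt{\bar\gamma_{\rm cas}\gamma_{\rm cas}}+\sqrt{\bar\gamma_{\rm dir}\gamma_{\rm dir}})^2/W=\bar\gamma_{\rm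 cas}\gamma_{\rm a2g}/W$. For a partition $p=(p_1,\dots,p_r)$ of $n$ whose distinct parts $p_{\langle i\rangle}$ have multiplicities $\nu_i$ and a sequence $f$, write $T_p(f)=n!\prod_j\frac1{p_j!}\prod_i\frac{f(p_{\langle i\rangle})^{\nu_i}}{\nu_i!}$. **Theorem.** (a) *Moments.* All moments below are finite. For every integer $j\ge0$, $\mathbb E[\gamma_{\rm cas}^{j/2}]=\sum_{p\vdash j}\frac{N!}{(N-r)!}T_p(\mu)$ (terms with $r>N$ being $0$), where $\mu_i=M(K_{\rm UR},\tfrac i2)M(K_{\rm RD},\tfrac i2)$, $M(K,k)=\Gamma(1+k)L_k(-K)/(1+K)^k$ and $L_k(x)={}_1F_1(-k;1;x)$ is the Laguerre function. For every integer $i\ge1$, $$\mathbb E[\gamma^{i/2}]=\frac{\pi_1}{1-\beta}\,\frac{Q_{i+1,0}\big(\sqrt{2K_{\rm UD}},\sqrt{2\lambda_{\rm UD}\tau}\big)}{(2\lambda_{\rm UD}\sigma_{\rm D}^2\bar\gamma_{\rm cas}/P_{\rm U})^{i/2}},$$ with the Nuttall function $Q_{m,n}(a,b)=\int_b^\infty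 t^me^{-(t^2+a^2)/2}I_n(at)\,dt$, and $\beta=1-Q_{1,0}(\sqrt{2K_{\rm UD}},\sqrt{2\lambda_{\rm UD}\tau})$. For every integer $k\ge0$, $\mu_{k}:=\mathbb E[\gamma_{\rm a2g}^k]=\sum_{i=0}^{2k}\binom{2k}{i}\mathbb E[\gamma_{\rm cas}^{k-i/2}]\,\mathbb E[\gamma^{i/2}]$. (b) *Interference.* With $c_X=\bar\gamma_X/(K_X+1)$, for $s\ge0$: $\mathbb E[e^{-sW}]=\Delta_{\rm D}^{(0)}(s):=e^{-s}\prod_X\frac{e^{-K_X+K_X/(1+c_Xs)}}{1+c_Xs}$, and for $n\ge0$ its $n$-th derivative is $\Delta_{\rm D}^{(n)}(s)=\Delta_{\rm D}^{(0)}(s)\sum_{p\vdash n}T_p(S(s))$, where $S_i(s)=\sum_X(i-1)!\frac{(-c_X)^i}{(1+c_Xs)^i}\big(1+\frac{iK_X}{1+c_Xs}\big)-C_i$, $C_1=1$, $C_i=0$ for $i\ge2$. (c) *CDF.* For every $x$, $\Pr(\Gamma^\star_{\rm a2g}\le x)=F_\nu(x)$ for $\nu$ the law of $\gamma_{\rm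 a2g}$, where $F_\nu$ denotes the CDF of $\bar\gamma_{\rm cas}Y/W$ with $Y\sim\nu$ independent of $W$. The law of $\gamma_{\rm a2g}$ is approximated by that of a sum of independent shadowed Rician variables (SISR) with the same first two moments, as follows. Let $I\ge1$ be an integer and $\psi>1$ a real number with $I\psi$ an integer and $I\le\lfloor\mu_1^2/(\mu_2-\mu_1^2)\rfloor$; put $\Omega=\frac{\sqrt\psi}{\sqrt{\psi-1}}\frac{\sqrt{\mu_1^2(I+1)-I\mu_2}}{I}$, $\sigma^2=\frac{\mu_1-I\Omega}{I}$, assumed positive, $\kappa=\frac{1-\sigma^2}{\sigma^2}$, $\xi=\frac{\Omega(\kappa+1)}{\psi}$, $\alpha_{\rm cas}=\frac{\xi+1}{\kappa+1}$, $\chi_{I,k}=\binom{I\psi-I}{k}\frac1{(\xi+1)^k}\big(\frac{\xi}{\xi+1}\big)^{I\psi-I-k}$. Let $\nu$ be the law of $Y=\sum_{i=1}^I|Z_i+\zeta_iu_i|^2$, with $Z_i\sim\mathcal{CN}(0,\sigma^2)$, $\zeta_i$ Nakagami with shape $\psi$ and $\mathbb E\zeta_i^2=\Omega$ ($\zeta_i=0$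 if $\Omega=0$), all independent, and constants $|u_i|=1$. Then $\mathbb E[Y]=\mathbb E[\gamma_{\rm a2g}]$, $\mathbb E[Y^2]=\mathbb E[\gamma_{\rm a2g}^2]$, and the CDF of the A2G SINR under this approximation is, for all $x>0$, $$F_\nu(x)=1-\sum_{k=0}^{I\psi-I}\chi_{I,k}\sum_{n=0}^{I\psi-k-1}\frac{(-s_0)^n\,\Delta_{\rm D}^{(n)}(s_0)}{n!},\qquad s_0=\frac{x}{\alpha_{\rm cas}\bar\gamma_{\rm cas}}.$$ -/

import Mathlib

open MeasureTheory ProbabilityTheory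
open scoped Nat

noncomputable section

namespace A2G

/-! ### Special functions -/

/-- Modified Bessel function of the first kind, of integer order `n`. -/
def besselI (n : ℕ) (x : ℝ) : ℝ :=
  ∑' k : ℕ, (x / 2) ^ (2 * k + n) / ((k ! : ℝ) * ((k + n)! : ℝ))

/-- Nuttall `Q`-function `Q_{m,n}(a,b) = ∫_b^∞ t^m e^{-(t²+a²)/2} I_n(a t) dt`.
`Q_{1,0}` is the first order Marcum `Q`-function. -/
def nuttallQ (m n : ℕ) (a b : ℝ) : ℝ :=
  ∫ t in Set.Ioi b, t ^ m * Real.exp (-(t ^ 2 + a ^ 2) / 2) * besselI n (a * t)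

/-- Laguerre function of real order `ν`, `L_ν(x) = ₁F₁(-ν; 1; x)`; the Laguerre polynomial
for `ν ∈ ℕ`. -/
def laguerreFn (ν x : ℝ) : ℝ :=
  ∑' n : ℕ, (ascPochhammer ℝ n).eval (-ν) / ((n ! : ℝ) ^ 2) * x ^ n

/-- The term of a partition `p = (p₁, …, p_r)` of `n` in the multinomial and Faà di Bruno
formulas: `n! ∏_j 1/p_j! ∏_i f(p_⟨i⟩)^{ν_i} / ν_i!`, where `p_⟨i⟩` are the distinct parts
and `ν_i` their multiplicities. -/
def partitionTerm {n : ℕ} (p : n.Partition) (f : ℕ → ℝ) : ℝ :=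
  (n ! : ℝ) * (p.parts.map fun j => ((j ! : ℝ))⁻¹).prod *
    ∏ j ∈ p.parts.toFinset, f j ^ p.parts.count j / ((p.parts.count j)! : ℝ)

/-! ### Distributions -/

/-- Circularly symmetric complex Gaussian law `CN(0, v)`. -/
def complexGaussian (v : ℝ) : Measure ℂ :=
  ((gaussianReal 0 (v / 2).toNNReal).prod (gaussianReal 0 (v / 2).toNNReal)).map
    fun q => (⟨q.1, q.2⟩ : ℂ)

/-- Law of the Rician small-scale fading coefficient `(√K u + z) / √(K+1)`,
`z ~ CN(0,1)`, with line-of-sight component `u`. -/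
def ricianFading (K : ℝ) (u : ℂ) : Measure ℂ :=
  (complexGaussian 1).map fun z => ((√K : ℝ) * u + z) / ((√(K + 1) : ℝ) : ℂ)

/-- Nakagami law with shape `ψ` and spread `Om`: the law of `√(Om G / ψ)` for
`G ~ Gamma(ψ, 1)` (the point mass at `0` if `Om = 0`). -/
def nakagami (ψ Om : ℝ) : Measure ℝ :=
  (gammaMeasure ψ 1).map fun g => √(Om * g / ψ)

/-- Shadowed Rician power law: the law of `|Z + ξ u|²` with independent `Z ~ CN(0, s2)` and
`ξ` Nakagami with shape `ψ` and spread `Om`. -/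
def shadowedRician (ψ Om s2 : ℝ) (u : ℂ) : Measure ℝ :=
  ((complexGaussian s2).prod (nakagami ψ Om)).map fun q => ‖q.1 + (q.2 : ℂ) * u‖ ^ 2

/-- Law of a sum of `I` independent shadowed Rician powers (SISR law). -/
def sisr (I : ℕ) (ψ Om s2 : ℝ) (u : Fin I → ℂ) : Measure ℝ :=
  (Measure.pi fun i => shadowedRician ψ Om s2 (u i)).map fun x => ∑ i, x i

/-! ### Parameters of the SISR law with prescribed first two moments `μ₁`, `μ₂` -/

def sisrOmega (I : ℕ) (ψ μ₁ μ₂ : ℝ) : ℝ :=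
  √ψ / √(ψ - 1) * (√(μ₁ ^ 2 * (I + 1) - I * μ₂) / I)

def sisrSigma2 (I : ℕ) (ψ μ₁ μ₂ : ℝ) : ℝ :=
  (μ₁ - I * sisrOmega I ψ μ₁ μ₂) / I

def sisrKappa (I : ℕ) (ψ μ₁ μ₂ : ℝ) : ℝ :=
  (1 - sisrSigma2 I ψ μ₁ μ₂) / sisrSigma2 I ψ μ₁ μ₂

/-- `ξ = κ ω / ψ` with `κ ω = Ω (κ + 1)`. -/
def sisrXi (I : ℕ) (ψ μ₁ μ₂ : ℝ) : ℝ :=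
  sisrOmega I ψ μ₁ μ₂ * (sisrKappa I ψ μ₁ μ₂ + 1) / ψ

def sisrAlpha (I : ℕ) (ψ μ₁ μ₂ : ℝ) : ℝ :=
  (sisrXi I ψ μ₁ μ₂ + 1) / (sisrKappa I ψ μ₁ μ₂ + 1)

/-- The weight `χ_{I,k}`; here `m = I ψ`. -/
def sisrChi (I m : ℕ) (ψ μ₁ μ₂ : ℝ) (k : ℕ) : ℝ :=
  ((m - I).choose k : ℝ) * (1 / (sisrXi I ψ μ₁ μ₂ + 1) ^ k) *
    (sisrXi I ψ μ₁ μ₂ / (sisrXi I ψ μ₁ μ₂ + 1)) ^ (m - I - k)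

/-! ### The system -/

/-- The links that end at the receiver or pass through the RIS: UAV to RIS element, RIS element
to receiver, UAV to receiver, aerial and ground interferer to receiver. -/
inductive Link (N L K : ℕ)
  | ur (n : Fin N)
  | rd (n : Fin N)
  | ud
  | aerial (l : Fin L)
  | ground (k : Fin K)

/-- Deterministic parameters of a system with `N` RIS elements, `L` aerial and `K` ground
interferers. -/
structure System (N L K : ℕ) where
  /-- transmit power of the UAV -/
  PU : ℝ
  /-- noise variance at the receiver -/
  noise : ℝ
  /-- amplitude reflection coefficient of the RIS elements -/
  refl : ℝ
  /-- blockage threshold for the power gain of the direct link -/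
  τ : ℝ
  /-- path losses -/
  lossUR : ℝ
  lossRD : ℝ
  lossUD : ℝ
  lossI : Fin L → ℝ
  lossJ : Fin K → ℝ
  /-- Rician `K`-factors -/
  riceUR : ℝ
  riceRD : ℝ
  riceUD : ℝ
  riceI : Fin L → ℝ
  riceJ : Fin K → ℝ
  /-- transmit powers of the interferers -/
  PI : Fin L → ℝ
  PJ : Fin K → ℝ
  /-- line-of-sight components -/
  los : Link N L K → ℂ
  PU_pos : 0 < PU
  noise_pos : 0 < noise
  refl_pos : 0 < refl
  refl_le_one : refl ≤ 1
  τ_nonneg : 0 ≤ τ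
  lossUR_pos : 0 < lossUR
  lossRD_pos : 0 < lossRD
  lossUD_pos : 0 < lossUD
  lossI_pos : ∀ l, 0 < lossI l
  lossJ_pos : ∀ k, 0 < lossJ k
  riceUR_nonneg : 0 ≤ riceUR
  riceRD_nonneg : 0 ≤ riceRD
  riceUD_nonneg : 0 ≤ riceUD
  riceI_nonneg : ∀ l, 0 ≤ riceI l
  riceJ_nonneg : ∀ k, 0 ≤ riceJ k
  PI_nonneg : ∀ l, 0 ≤ PI l
  PJ_nonneg : ∀ k, 0 ≤ PJ k
  norm_los : ∀ e, ‖los e‖ = 1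

namespace System

variable {N L K : ℕ} (S : System N L K)

/-- The Rician factor of a link. -/
def rice : Link N L K → ℝ
  | .ur _ => S.riceUR
  | .rd _ => S.riceRD
  | .ud => S.riceUD
  | .aerial l => S.riceI l
  | .ground k => S.riceJ k

/-- Average SNR `γ̄_cas` of the cascaded link. -/
def snrCas : ℝ := S.PU * S.lossUR * S.lossRD * |S.refl| ^ 2 / S.noise

/-- Average SNR `γ̄_dir` of the direct link. -/
def snrDir : ℝ := S.PU * S.lossUD / S.noise

/-- Average interference-to-noise ratios `γ̄_{I_l D}`, `γ̄_{J_k D}`. -/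
def inrI (l : Fin L) : ℝ := S.PI l * S.lossI l / S.noise

def inrJ (k : Fin K) : ℝ := S.PJ k * S.lossJ k / S.noise

/-- `λ_UD = (K_UD + 1) / ℓ_UD`. -/
def lamUD : ℝ := (S.riceUD + 1) / S.lossUD

/-- Blockage probability `β = Pr(|g_UD|² < τ)`, where `|g_UD|² = ℓ_UD |h_UD|²`. -/
def blockProb : ℝ :=
  (ricianFading S.riceUD (S.los .ud)).real {z | S.lossUD * ‖z‖ ^ 2 < S.τ}

/-- Transition matrix of the blockage chain: state `0` (blocked) is entered with probability `β`,
state `1` (unblocked) with probability `1 - β`, from either state. -/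
def transition : Matrix (Fin 2) (Fin 2) ℝ :=
  !![S.blockProb, 1 - S.blockProb; S.blockProb, 1 - S.blockProb]

/-- Steady-state probabilities `(π₀, π₁)` of the blockage chain. -/
def steady : Fin 2 → ℝ :=
  ![S.transition 1 0 / (S.transition 0 1 + S.transition 1 0),
    S.transition 0 1 / (S.transition 0 1 + S.transition 1 0)]

/-! Closed-form moments -/

/-- `μ_{k,|h|²} = Γ(1+k) L_k(-K) / (1+K)^k` for a Rician coefficient with factor `K`. -/
def momRice (K k : ℝ) : ℝ := Real.Gamma (1 + k) * laguerreFn k (-K) / (1 + K) ^ k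

/-- Closed form of `μ_{j/2, γ_cas}`; the sum over the partitions of `j` into `r` parts, for all
`r`, and `N.descFactorial r = N! / (N - r)!` (zero for `r > N`). -/
def momCas (j : ℕ) : ℝ :=
  ∑ p : j.Partition, (N.descFactorial p.parts.card : ℝ) *
    partitionTerm p fun i => momRice S.riceUR ((i : ℝ) / 2) * momRice S.riceRD ((i : ℝ) / 2)

/-- Closed form of `μ_{i/2, γ}`, `γ = γ_dir γ̄_dir / γ̄_cas`, by the Nuttall `Q`-function. -/
def momDir (i : ℕ) : ℝ :=
  if i = 0 then 1 else
    S.steady 1 / (1 - S.blockProb) *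
      (nuttallQ (i + 1) 0 √(2 * S.riceUD) √(2 * S.lamUD * S.τ) /
        (2 * S.lamUD * S.noise * S.snrCas / S.PU) ^ ((i : ℝ) / 2))

/-- Closed form of `μ_{k, γ_a2g}`. -/
def momA2G (k : ℕ) : ℝ :=
  ∑ i ∈ Finset.range (2 * k + 1), ((2 * k).choose i : ℝ) * S.momCas (2 * k - i) * S.momDir i

/-! Interference -/

/-- Laplace transform at `s` of `c̄ |h|²`, where `h` is a Rician coefficient with factor `K`,
`E|h|² = 1`, and `c = c̄ / (K + 1)`. -/
def riceLaplace (K c s : ℝ) : ℝ := Real.exp (-K + K / (1 + c * s)) / (1 + c * s)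

/-- The function `Δ_D^{(0)}`. -/
def delta0 (s : ℝ) : ℝ :=
  Real.exp (-s) * (∏ l, riceLaplace (S.riceI l) (S.inrI l / (S.riceI l + 1)) s) *
    ∏ k, riceLaplace (S.riceJ k) (S.inrJ k / (S.riceJ k + 1)) s

/-- `δ^{(n)}(s) = (n-1)! (-c)^n / (1 + c s)^n (1 + n K / (1 + c s))`. -/
def smallDelta (K c : ℝ) (n : ℕ) (s : ℝ) : ℝ :=
  ((n - 1)! : ℝ) * ((-c) ^ n / (1 + c * s) ^ n) * (1 + n * K / (1 + c * s))

/-- `S_i(s)`. -/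
def logDeriv (s : ℝ) (i : ℕ) : ℝ :=
  (∑ l, smallDelta (S.riceI l) (S.inrI l / (S.riceI l + 1)) i s) +
    (∑ k, smallDelta (S.riceJ k) (S.inrJ k / (S.riceJ k + 1)) i s) - if i = 1 then 1 else 0

/-- Closed form of `Δ_D^{(n)}`, the `n`-th derivative of `Δ_D^{(0)}`. -/
def delta (n : ℕ) (s : ℝ) : ℝ :=
  S.delta0 s * ∑ p : n.Partition, partitionTerm p (S.logDeriv s)

end System

/-- The random channels of the system: independent Rician coefficients `h`, and a blockage process
`state` that is a stationary Markov chain with the given transition matrix and whose initial state is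
`0` (blocked) exactly if the power gain of the direct link is below the threshold. -/
structure Channels {N L K : ℕ} (S : System N L K) {Ω : Type*} [MeasurableSpace Ω]
    (P : Measure Ω) where
  h : Link N L K → Ω → ℂ
  state : ℕ → Ω → Fin 2
  measurable_h : ∀ e, Measurable (h e)
  law_h : ∀ e, HasLaw (h e) (ricianFading (S.rice e) (S.los e)) P
  indep_h : iIndepFun h P
  measurable_state : ∀ t, Measurable (state t)
  markov_state : ∀ (T : ℕ) (a : Fin (T + 1) → Fin 2),
    P.real {ω | ∀ t : Fin (T + 1), state t ω = a t} =
      S.steady (a 0) * ∏ t : Fin T, S.transition (a t.castSucc) (a t.succ)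
  blocked_iff : ∀ᵐ ω ∂P, state 0 ω = 0 ↔ S.lossUD * ‖h .ud ω‖ ^ 2 < S.τ

namespace Channels

variable {N L K : ℕ} {S : System N L K} {Ω : Type*} [MeasurableSpace Ω] {P : Measure Ω}
  (C : Channels S P)

/-- `γ_cas = (∑ |h_{UR_n}| |h_{R_n D}|)²`. -/
def gCas (ω : Ω) : ℝ := (∑ n, ‖C.h (.ur n) ω‖ * ‖C.h (.rd n) ω‖) ^ 2

/-- `γ_dir = φ₀ |h_UD|²`. -/
def gDir (ω : Ω) : ℝ := ((C.state 0 ω : ℕ) : ℝ) * ‖C.h .ud ω‖ ^ 2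

/-- `γ = γ_dir γ̄_dir / γ̄_cas`. -/
def gDirN (ω : Ω) : ℝ := C.gDir ω * S.snrDir / S.snrCas

/-- Normalized SNR `γ_a2g = |√γ_cas + √γ|²`. -/
def gA2G (ω : Ω) : ℝ := |√(C.gCas ω) + √(C.gDirN ω)| ^ 2

/-- Aggregated interference-to-noise ratio `γ_ID + γ_JD` at the receiver. -/
def inr (ω : Ω) : ℝ :=
  (∑ l, S.inrI l * ‖C.h (.aerial l) ω‖ ^ 2) + ∑ k, S.inrJ k * ‖C.h (.ground k) ω‖ ^ 2

/-- The SINR `Γ*_a2g` at the receiver under the optimal phase shifts. -/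
def sinr (ω : Ω) : ℝ :=
  |√(S.snrCas * C.gCas ω) + √(S.snrDir * C.gDir ω)| ^ 2 / (C.inr ω + 1)

/-- CDF at `x` of `γ̄_cas Y / (γ_ID + γ_JD + 1)`, where `Y` has law `ν` and is independent of the
interference: the SINR distribution for a normalized SNR with law `ν`. -/
def sinrCDF (ν : Measure ℝ) (x : ℝ) : ℝ :=
  (ν.prod P).real {q | S.snrCas * q.1 / (C.inr q.2 + 1) ≤ x}

end Channels

end A2G

end

/-
Conditioned on a Poisson variable, `|h|²` is Gamma distributed, so its moments are Poisson averages
of ratios of Gamma functions (Laguerre functions, by Kummer's transformation) and its Laplace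
transform is `exp (-K + K / (1 + c s)) / (1 + c s)`. The derivatives of a product of such factors
are complete Bell polynomials in the derivatives of its logarithm, which is the sum over partitions
in `Δ_D^(n)`; the same sums expand the powers of a sum of i.i.d. variables by multiplicity type.
The law of a sum of `I` independent shadowed Rician powers has the Laplace transform of a binomial
mixture of Erlang laws, and is therefore that mixture. Since Erlang tails are finite sums of
`t ^ n * exp (-t) / n!`, conditioning on the interference turns the distribution function of the
SINR into the exponentially tilted moments `E[W ^ n * exp (-s₀ W)] = (-1) ^ n Δ_D^(n)(s₀)`.
-/

namespace A2G

/-! ### Sums over partitions -/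

section Partitions

/-- The factor of `partitionTerm` that depends on the multiset of parts only; it makes sense without
the partition, so that parts can be removed one at a time. -/
noncomputable def partsWeight (f : ℕ → ℝ) (s : Multiset ℕ) : ℝ :=
  (s.map fun j => ((j ! : ℝ))⁻¹).prod * ∏ j ∈ s.toFinset, f j ^ s.count j / ((s.count j)! : ℝ)

/-- The finite set of multisets of positive integers with sum `n`. -/
def partsOfSum (n : ℕ) : Finset (Multiset ℕ) :=
  (Finset.univ : Finset n.Partition).image Nat.Partition.parts

lemma mem_partsOfSum {n : ℕ} {s : Multiset ℕ} :
    s ∈ partsOfSum n ↔ (∀ i ∈ s, 0 < i) ∧ s.sum = n := by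
  simp only [partsOfSum, Finset.mem_image, Finset.mem_univ, true_and]
  constructor
  · rintro ⟨p, rfl⟩
    exact ⟨fun i hi => p.parts_pos hi, p.parts_sum⟩
  · rintro ⟨hpos, hsum⟩
    exact ⟨⟨s, fun {i} hi => hpos i hi, hsum⟩, rfl⟩

lemma cons_mem_partsOfSum {n k : ℕ} {s : Multiset ℕ} (hk : k ≤ n) (hs : s ∈ partsOfSum (n - k)) :
    (k + 1) ::ₘ s ∈ partsOfSum (n + 1) := by
  rw [mem_partsOfSum] at hs ⊢
  refine ⟨fun i hi => ?_, by rw [Multiset.sum_cons]; omega⟩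
  rcases Multiset.mem_cons.1 hi with rfl | hi
  · exact k.succ_pos
  · exact hs.1 i hi

lemma erase_mem_partsOfSum {n j : ℕ} {s : Multiset ℕ} (hs : s ∈ partsOfSum (n + 1)) (hj : j ∈ s) :
    0 < j ∧ j ≤ n + 1 ∧ s.erase j ∈ partsOfSum (n - (j - 1)) := by
  simp only [mem_partsOfSum] at hs ⊢
  have hsum := Multiset.sum_erase hj
  have hpos := hs.1 j hj
  exact ⟨hpos, by omega, fun i hi => hs.1 i (Multiset.mem_of_mem_erase hi), by omega⟩

lemma sum_partition_parts {α : Type*} [AddCommMonoid α] (n : ℕ) (F : Multiset ℕ → α) :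
    ∑ p : n.Partition, F p.parts = ∑ s ∈ partsOfSum n, F s := by
  rw [partsOfSum, Finset.sum_image fun p _ q _ h => Nat.Partition.ext h]

lemma sum_partsOfSum_succ_sum_erase {α : Type*} [AddCommMonoid α] (n : ℕ)
    (F : ℕ → Multiset ℕ → α) :
    ∑ s ∈ partsOfSum (n + 1), ∑ j ∈ s.toFinset, F j (s.erase j) =
      ∑ k ∈ Finset.range (n + 1), ∑ t ∈ partsOfSum (n - k), F (k + 1) t := by
  rw [Finset.sum_sigma', Finset.sum_sigma']
  refine Finset.sum_bij' (fun x _ => ⟨x.2 - 1, x.1.erase x.2⟩)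
    (fun y _ => ⟨(y.1 + 1) ::ₘ y.2, y.1 + 1⟩) ?_ ?_ ?_ ?_ ?_ <;>
    simp only [Sigma.forall, Finset.mem_sigma, Multiset.mem_toFinset, Finset.mem_range]
  · rintro s j ⟨hs, hj⟩
    obtain ⟨hj0, hjn, ht⟩ := erase_mem_partsOfSum hs hj
    exact ⟨by omega, ht⟩
  · rintro k t ⟨hk, ht⟩
    exact ⟨cons_mem_partsOfSum (Nat.lt_succ_iff.1 hk) ht, Multiset.mem_cons_self _ _⟩
  · rintro s j ⟨hs, hj⟩
    rw [Nat.sub_add_cancel (erase_mem_partsOfSum hs hj).1, Multiset.cons_erase hj]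
  · intro k t _
    rw [Multiset.erase_cons_head, Nat.add_sub_cancel]
  · rintro s j ⟨hs, hj⟩
    rw [Nat.sub_add_cancel (erase_mem_partsOfSum hs hj).1]

lemma partitionTerm_eq_factorial_mul {n : ℕ} (p : n.Partition) (f : ℕ → ℝ) :
    partitionTerm p f = n ! * partsWeight f p.parts := by
  rw [partitionTerm, partsWeight, mul_assoc]

lemma count_mul_partsWeight_cons (f : ℕ → ℝ) (s : Multiset ℕ) (j : ℕ) :
    ((j ::ₘ s).count j : ℝ) * partsWeight f (j ::ₘ s) = (j ! : ℝ)⁻¹ * f j * partsWeight f s := by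
  let w : Multiset ℕ → ℕ → ℝ := fun t i => f i ^ t.count i / ((t.count i)! : ℝ)
  have hinsert : ∏ i ∈ s.toFinset, w s i = ∏ i ∈ insert j s.toFinset, w s i := by
    refine Finset.prod_subset (Finset.subset_insert _ _) fun i _ hi => ?_
    simp [w, Multiset.count_eq_zero.2 (mt Multiset.mem_toFinset.2 hi)]
  have hne : ∏ i ∈ (insert j s.toFinset).erase j, w (j ::ₘ s) i =
      ∏ i ∈ (insert j s.toFinset).erase j, w s i :=
    Finset.prod_congr rfl fun i hi => by
      simp only [w, Multiset.count_cons_of_ne (Finset.ne_of_mem_erase hi)]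
  have hj : ((s.count j : ℝ) + 1) * w (j ::ₘ s) j = f j * w s j := by
    have : ((s.count j : ℝ) + 1) ≠ 0 := by positivity
    simp only [w, Multiset.count_cons_self, Nat.factorial_succ, Nat.cast_mul, Nat.cast_succ]
    field_simp
    ring
  change _ * (_ * ∏ i ∈ (j ::ₘ s).toFinset, w (j ::ₘ s) i) =
    _ * (_ * ∏ i ∈ s.toFinset, w s i)
  rw [hinsert, Multiset.toFinset_cons, ← Finset.mul_prod_erase _ _ (Finset.mem_insert_self j _),
    ← Finset.mul_prod_erase _ (w s) (Finset.mem_insert_self j _), hne, Multiset.map_cons,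
    Multiset.prod_cons, Multiset.count_cons_self, Nat.cast_succ]
  linear_combination (j ! : ℝ)⁻¹ * (s.map fun i => (i ! : ℝ)⁻¹).prod *
    (∏ i ∈ (insert j s.toFinset).erase j, w s i) * hj

lemma succ_mul_eq_sum_toFinset {n : ℕ} {s : Multiset ℕ} (hs : s ∈ partsOfSum (n + 1)) (a : ℝ) :
    (n + 1) * a = ∑ j ∈ s.toFinset, j * (s.count j * a) := by
  have hsum : ((n + 1 : ℕ) : ℝ) = ∑ j ∈ s.toFinset, (j : ℝ) * s.count j := by
    rw [← (mem_partsOfSum.1 hs).2, Finset.sum_multiset_count]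
    push_cast [smul_eq_mul]
    exact Finset.sum_congr rfl fun j _ => mul_comm _ _
  rw [← Nat.cast_succ, hsum, Finset.sum_mul]
  exact Finset.sum_congr rfl fun j _ => mul_assoc _ _ _

/-- Writing `n + 1 = ∑ j · count j` marks one part `j = k + 1`, which is then removed. -/
theorem sum_partitionTerm_succ (g f : ℕ → ℝ) (n : ℕ) :
    ∑ p : (n + 1).Partition, g p.parts.card * partitionTerm p f =
      ∑ k ∈ Finset.range (n + 1), (n.choose k : ℝ) * f (k + 1) *
        ∑ q : (n - k).Partition, g (q.parts.card + 1) * partitionTerm q f := by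
  simp only [partitionTerm_eq_factorial_mul]
  let F : ℕ → Multiset ℕ → ℝ := fun j t =>
    j * (g (t.card + 1) * (n ! * ((j ! : ℝ)⁻¹ * f j * partsWeight f t)))
  have hmark : ∀ s ∈ partsOfSum (n + 1),
      g s.card * ((n + 1)! * partsWeight f s) = ∑ j ∈ s.toFinset, F j (s.erase j) := by
    intro s hs
    calc g s.card * ((n + 1)! * partsWeight f s)
        = (n + 1) * (g s.card * (n ! * partsWeight f s)) := by
          rw [Nat.factorial_succ]; push_cast; ring
      _ = ∑ j ∈ s.toFinset, j * (s.count j * (g s.card * (n ! * partsWeight f s))) :=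
          succ_mul_eq_sum_toFinset hs _
      _ = _ := Finset.sum_congr rfl fun j hj => by
          obtain ⟨t, rfl⟩ := Multiset.exists_cons_of_mem (Multiset.mem_toFinset.1 hj)
          simp only [F, Multiset.erase_cons_head, Multiset.card_cons]
          linear_combination (j : ℝ) * g (t.card + 1) * n ! * count_mul_partsWeight_cons f t j
  have hremove : ∀ k ∈ Finset.range (n + 1), ∑ t ∈ partsOfSum (n - k), F (k + 1) t =
      (n.choose k : ℝ) * f (k + 1) *
        ∑ t ∈ partsOfSum (n - k), g (t.card + 1) * ((n - k)! * partsWeight f t) := by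
    intro k hk
    rw [Finset.mul_sum]
    refine Finset.sum_congr rfl fun t _ => ?_
    simp only [F, Nat.cast_choose ℝ (Finset.mem_range_succ_iff.1 hk), Nat.factorial_succ]
    push_cast
    field_simp
  rw [sum_partition_parts (n + 1) fun s => g s.card * ((n + 1)! * partsWeight f s),
    Finset.sum_congr rfl hmark, sum_partsOfSum_succ_sum_erase, Finset.sum_congr rfl hremove]
  exact Finset.sum_congr rfl fun k _ => congrArg _
    (sum_partition_parts (n - k) fun t => g (t.card + 1) * ((n - k)! * partsWeight f t)).symm

lemma sum_partitionTerm_zero (g f : ℕ → ℝ) :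
    ∑ p : (0 : ℕ).Partition, g p.parts.card * partitionTerm p f = g 0 := by
  rw [Fintype.sum_unique]
  simp [partitionTerm, Nat.Partition.partition_zero_parts]

/-- The complete Bell polynomial `∑_{p ⊢ n} T_p(f)` in the variables `f 1, …, f n`. -/
noncomputable def completeBell (f : ℕ → ℝ) (n : ℕ) : ℝ :=
  ∑ p : n.Partition, partitionTerm p f

lemma completeBell_zero (f : ℕ → ℝ) : completeBell f 0 = 1 := by
  simpa [completeBell] using sum_partitionTerm_zero (fun _ => 1) f

lemma completeBell_succ (f : ℕ → ℝ) (n : ℕ) :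
    completeBell f (n + 1) =
      ∑ k ∈ Finset.range (n + 1), (n.choose k : ℝ) * (f (k + 1) * completeBell f (n - k)) := by
  simpa [completeBell, mul_assoc] using sum_partitionTerm_succ (fun _ => 1) f n

end Partitions

/-! ### Derivatives of a function with known logarithmic derivatives -/

section LogDerivatives

variable {F : ℝ → ℝ} {G : ℝ → ℕ → ℝ} {U : Set ℝ}

lemma hasDerivAt_mul_completeBell (hF : ∀ s ∈ U, HasDerivAt F (F s * G s 1) s)
    (hG : ∀ s ∈ U, ∀ i, 1 ≤ i → HasDerivAt (fun t => G t i) (G s (i + 1)) s) (n : ℕ) {s : ℝ}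
    (hs : s ∈ U) :
    HasDerivAt (fun t => F t * completeBell (G t) n) (F s * completeBell (G s) (n + 1)) s := by
  have hrec : ∀ t m, F t * completeBell (G t) (m + 1) = ∑ k ∈ Finset.range (m + 1),
      (m.choose k : ℝ) * (G t (k + 1) * (F t * completeBell (G t) (m - k))) := fun t m => by
    rw [completeBell_succ, Finset.mul_sum]
    exact Finset.sum_congr rfl fun k _ => by ring
  induction n using Nat.strong_induction_on with
  | _ n ih =>
    cases n with
    | zero => simpa [completeBell_zero, completeBell_succ] using hF s hs
    | succ n =>
      simp only [hrec _ n]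
      have hterm : ∀ k ∈ Finset.range (n + 1), HasDerivAt
          (fun t => (n.choose k : ℝ) * (G t (k + 1) * (F t * completeBell (G t) (n - k))))
          ((n.choose k : ℝ) * (G s (k + 1) * (F s * completeBell (G s) (n + 1 - k))) +
            (n.choose k : ℝ) * (G s (k + 1 + 1) * (F s * completeBell (G s) (n - k)))) s := by
        intro k hk
        have hk' := Finset.mem_range_succ_iff.1 hk
        refine (((hG s hs (k + 1) k.succ_pos).mul (ih (n - k) (by omega))).const_mul _).congr_deriv
          ?_
        rw [show n - k + 1 = n + 1 - k by omega]
        ring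
      refine (HasDerivAt.fun_sum hterm).congr_deriv ?_
      rw [hrec s (n + 1), Finset.sum_add_distrib]
      exact (Finset.sum_choose_succ_mul
        (fun i j => G s (i + 1) * (F s * completeBell (G s) j)) n).symm

theorem iteratedDeriv_eq_mul_completeBell (hU : IsOpen U)
    (hF : ∀ s ∈ U, HasDerivAt F (F s * G s 1) s)
    (hG : ∀ s ∈ U, ∀ i, 1 ≤ i → HasDerivAt (fun t => G t i) (G s (i + 1)) s) (n : ℕ) {s : ℝ}
    (hs : s ∈ U) :
    iteratedDeriv n F s = F s * completeBell (G s) n := by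
  induction n generalizing s with
  | zero => simp [completeBell_zero]
  | succ n ih =>
    have heq : iteratedDeriv n F =ᶠ[nhds s] fun t => F t * completeBell (G t) n :=
      Filter.eventually_of_mem (hU.mem_nhds hs) fun t ht => ih ht
    rw [iteratedDeriv_succ, heq.deriv_eq, (hasDerivAt_mul_completeBell hF hG n hs).deriv]

end LogDerivatives

/-! ### Laplace transforms of Rician interference -/

section RiceLaplace

open A2G.System

lemma hasDerivAt_one_add_const_mul (c s : ℝ) : HasDerivAt (fun s => 1 + c * s) c s := by
  simpa using ((hasDerivAt_id s).const_mul c).const_add 1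

lemma hasDerivAt_riceLaplace (K : ℝ) {c s : ℝ} (h : 1 + c * s ≠ 0) :
    HasDerivAt (riceLaplace K c) (riceLaplace K c s * smallDelta K c 1 s) s := by
  have hlin := hasDerivAt_one_add_const_mul c s
  have hexponent : HasDerivAt (fun s => -K + K / (1 + c * s)) (-(K * c) / (1 + c * s) ^ 2) s := by
    simpa using ((hasDerivAt_const s K).div hlin h).const_add (-K)
  refine (hexponent.exp.div hlin h).congr_deriv ?_
  simp only [riceLaplace, smallDelta, Nat.sub_self, Nat.factorial_zero, Nat.cast_one, pow_one]
  field_simp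
  ring

lemma hasDerivAt_smallDelta (K : ℝ) {c s : ℝ} (h : 1 + c * s ≠ 0) {i : ℕ} (hi : 1 ≤ i) :
    HasDerivAt (smallDelta K c i) (smallDelta K c (i + 1) s) s := by
  obtain ⟨k, rfl⟩ := Nat.exists_eq_add_of_le' hi
  have hlin := hasDerivAt_one_add_const_mul c s
  have hpow := (((hasDerivAt_const s ((-c) ^ (k + 1))).div (hlin.pow (k + 1))
    (pow_ne_zero _ h)).const_mul ((k + 1 - 1)! : ℝ))
  have hfrac := ((hasDerivAt_const s (((k + 1 : ℕ) : ℝ) * K)).div hlin h).const_add 1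
  refine (hpow.mul hfrac).congr_deriv ?_
  simp only [smallDelta, Nat.add_sub_cancel, Nat.factorial_succ, Pi.pow_apply, Pi.div_apply]
  push_cast
  field_simp
  ring

variable {ι : Type*} [Fintype ι] (K : ι → ℝ) {c : ι → ℝ}

lemma hasDerivAt_exp_neg_mul_prod_riceLaplace {s : ℝ} (h : ∀ x, 1 + c x * s ≠ 0) :
    HasDerivAt (fun s => Real.exp (-s) * ∏ x, riceLaplace (K x) (c x) s)
      ((Real.exp (-s) * ∏ x, riceLaplace (K x) (c x) s) *
        (∑ x, smallDelta (K x) (c x) 1 s - 1)) s := by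
  classical
  have hprod : HasDerivAt (fun s => ∏ x, riceLaplace (K x) (c x) s)
      ((∏ x, riceLaplace (K x) (c x) s) * ∑ x, smallDelta (K x) (c x) 1 s) s := by
    refine (HasDerivAt.fun_finsetProd (u := Finset.univ) fun x _ =>
      hasDerivAt_riceLaplace (K x) (h x)).congr_deriv ?_
    rw [Finset.mul_sum]
    refine Finset.sum_congr rfl fun x hx => ?_
    rw [← Finset.mul_prod_erase _ _ hx, smul_eq_mul]
    ring
  refine ((hasDerivAt_neg s).exp.mul hprod).congr_deriv ?_
  ring

theorem iteratedDeriv_exp_neg_mul_prod_riceLaplace (n : ℕ) {s : ℝ} (h : ∀ x, 1 + c x * s ≠ 0) :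
    iteratedDeriv n (fun s => Real.exp (-s) * ∏ x, riceLaplace (K x) (c x) s) s =
      (Real.exp (-s) * ∏ x, riceLaplace (K x) (c x) s) *
        completeBell (fun i => (∑ x, smallDelta (K x) (c x) i s) - if i = 1 then 1 else 0) n := by
  refine iteratedDeriv_eq_mul_completeBell (U := {s | ∀ x, 1 + c x * s ≠ 0})
    (G := fun s i => (∑ x, smallDelta (K x) (c x) i s) - if i = 1 then 1 else 0) ?_ ?_ ?_ n h
  · simp only [Set.ofPred_forall]
    exact isOpen_iInter_of_finite fun x => isOpen_ne_fun (by fun_prop) continuous_const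
  · intro s hs
    simpa only [if_true] using hasDerivAt_exp_neg_mul_prod_riceLaplace K hs
  · intro s hs i hi
    refine ((HasDerivAt.fun_sum fun x _ => hasDerivAt_smallDelta (K x) (hs x) hi).sub_const
      (if i = 1 then (1 : ℝ) else 0)).congr_deriv ?_
    rw [if_neg (by omega), sub_zero]

end RiceLaplace

namespace System

variable {N L K : ℕ} (S : System N L K)

/-- Rician factors of all interferers, aerial and ground ones in one family. -/
def riceInt : Fin L ⊕ Fin K → ℝ := Sum.elim S.riceI S.riceJ

/-- Average interference-to-noise ratios of all interferers, aerial and ground ones in one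
family. -/
noncomputable def inrInt : Fin L ⊕ Fin K → ℝ := Sum.elim S.inrI S.inrJ

lemma riceInt_nonneg : ∀ x, 0 ≤ S.riceInt x
  | .inl l => S.riceI_nonneg l
  | .inr k => S.riceJ_nonneg k

lemma inrInt_nonneg : ∀ x, 0 ≤ S.inrInt x
  | .inl l => div_nonneg (mul_nonneg (S.PI_nonneg l) (S.lossI_pos l).le) S.noise_pos.le
  | .inr k => div_nonneg (mul_nonneg (S.PJ_nonneg k) (S.lossJ_pos k).le) S.noise_pos.le

lemma delta0_eq (s : ℝ) :
    S.delta0 s = Real.exp (-s) *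
      ∏ x, riceLaplace (S.riceInt x) (S.inrInt x / (S.riceInt x + 1)) s := by
  rw [Fintype.prod_sum_type, ← mul_assoc]
  rfl

theorem iteratedDeriv_delta0 (n : ℕ) {s : ℝ} (hs : 0 ≤ s) :
    iteratedDeriv n S.delta0 s = S.delta n s := by
  have hne : ∀ x, 1 + S.inrInt x / (S.riceInt x + 1) * s ≠ 0 := fun x => by
    have := S.inrInt_nonneg x
    have := S.riceInt_nonneg x
    positivity
  have h := iteratedDeriv_exp_neg_mul_prod_riceLaplace S.riceInt n hne
  simp only [← delta0_eq, Fintype.sum_sum_type] at h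
  exact h

end System

/-! ### Moments of sums of independent random variables -/

section IndependentSums

variable {Ω : Type*} [MeasurableSpace Ω] {P : Measure Ω}

lemma iIndepFun_curry {ι : Type*} {κ : ι → Type*} {E : (i : ι) → κ i → Type*}
    [∀ i j, MeasurableSpace (E i j)] {X : (i : ι) → (j : κ i) → Ω → E i j}
    (hX : ∀ i j, Measurable (X i j)) (h : iIndepFun (fun p : (i : ι) × κ i => X p.1 p.2) P) :
    iIndepFun (fun i ω j => X i j ω) P := by
  have := h.isProbabilityMeasure
  have : ∀ i j, IsProbabilityMeasure (P.map (X i j)) := fun i j =>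
    Measure.isProbabilityMeasure_map (hX i j).aemeasurable
  have hrow : ∀ i, P.map (fun ω j => X i j ω) = Measure.infinitePi fun j => P.map (X i j) :=
    fun i => (h.precomp sigma_mk_injective).map_fun_eq_infinitePi_map (hX i)
  rw [iIndepFun_iff_map_fun_eq_infinitePi_map (by fun_prop)]
  simp only [hrow]
  rw [← Measure.infinitePi_map_piCurry, ← h.map_fun_eq_infinitePi_map (by fun_prop),
    Measure.map_map (by fun_prop) (by fun_prop)]
  rfl

lemma memLp_natCast_iff_integrable_pow {f : Ω → ℝ} (hf : AEStronglyMeasurable f P) {n : ℕ}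
    (hn : n ≠ 0) : MemLp f n P ↔ Integrable (fun ω => f ω ^ n) P := by
  rw [← integrable_norm_rpow_iff hf (by exact_mod_cast hn) (ENNReal.natCast_ne_top n),
    ← integrable_norm_iff (f := fun ω => f ω ^ n) (hf.pow n)]
  simp [norm_pow]

variable {ι : Type*} {X : ι → Ω → ℝ}

lemma integrable_sum_pow [IsFiniteMeasure P] (hX : ∀ i n, Integrable (fun ω => X i ω ^ n) P)
    (s : Finset ι) (n : ℕ) : Integrable (fun ω => (∑ i ∈ s, X i ω) ^ n) P := by
  have hmeas : ∀ i, AEStronglyMeasurable (X i) P := fun i => by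
    simpa using (hX i 1).aestronglyMeasurable
  rcases eq_or_ne n 0 with rfl | hn
  · simp
  · rw [← memLp_natCast_iff_integrable_pow (by fun_prop) hn]
    exact memLp_finsetSum s fun i _ => (memLp_natCast_iff_integrable_pow (hmeas i) hn).2 (hX i n)

lemma integral_mul_add_pow {Y Z : Ω → ℝ} (hYZ : IndepFun Y Z P)
    (hY : ∀ n, Integrable (fun ω => Y ω ^ n) P) (hZ : ∀ n, Integrable (fun ω => Z ω ^ n) P)
    (n : ℕ) :
    Integrable (fun ω => Y ω * (Y ω + Z ω) ^ n) P ∧ ∫ ω, Y ω * (Y ω + Z ω) ^ n ∂P =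
      ∑ k ∈ Finset.range (n + 1),
        (n.choose k : ℝ) * (∫ ω, Y ω ^ (k + 1) ∂P) * ∫ ω, Z ω ^ (n - k) ∂P := by
  have hind : ∀ a b : ℕ, IndepFun (fun ω => Y ω ^ a) (fun ω => Z ω ^ b) P := fun a b =>
    hYZ.comp (measurable_id.pow_const a) (measurable_id.pow_const b)
  have hexpand : ∀ ω, Y ω * (Y ω + Z ω) ^ n =
      ∑ k ∈ Finset.range (n + 1), (n.choose k : ℝ) * (Y ω ^ (k + 1) * Z ω ^ (n - k)) := fun ω => by
    rw [add_pow, Finset.mul_sum]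
    exact Finset.sum_congr rfl fun k _ => by ring
  have hint : ∀ k ∈ Finset.range (n + 1),
      Integrable (fun ω => (n.choose k : ℝ) * (Y ω ^ (k + 1) * Z ω ^ (n - k))) P := fun k _ =>
    ((hind _ _).integrable_mul (hY _) (hZ _)).const_mul _
  simp only [hexpand]
  refine ⟨integrable_finsetSum _ hint, ?_⟩
  rw [integral_finsetSum _ hint]
  refine Finset.sum_congr rfl fun k _ => ?_
  rw [integral_const_mul, (hind _ _).integral_fun_mul_eq_mul_integral
    (hY _).aestronglyMeasurable (hZ _).aestronglyMeasurable, mul_assoc]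

lemma mul_pred_descFactorial (m r : ℕ) :
    m * (m - 1).descFactorial r = m.descFactorial (r + 1) := by
  cases m with
  | zero => simp
  | succ m => rw [Nat.add_sub_cancel, Nat.succ_descFactorial_succ]

/-- Peeling one factor `∑ X i` off the power splits each summand into `X i` and an independent
remainder, which yields the recursion of `sum_partitionTerm_succ`. -/
theorem integral_sum_pow_eq_sum_partitionTerm {μ : ℕ → ℝ} (hind : iIndepFun X P)
    (hX : ∀ i n, Integrable (fun ω => X i ω ^ n) P) (hμ : ∀ i n, ∫ ω, X i ω ^ n ∂P = μ n)
    (s : Finset ι) (n : ℕ) :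
    ∫ ω, (∑ i ∈ s, X i ω) ^ n ∂P =
      ∑ p : n.Partition, (s.card.descFactorial p.parts.card : ℝ) * partitionTerm p μ := by
  classical
  have := hind.isProbabilityMeasure
  have hmeas : ∀ i, AEMeasurable (X i) P := fun i => by simpa using (hX i 1).aemeasurable
  induction n using Nat.strong_induction_on generalizing s with
  | _ n ih =>
  cases n with
  | zero =>
    simpa using (sum_partitionTerm_zero (fun r => (s.card.descFactorial r : ℝ)) μ).symm
  | succ n =>
    have hrest : ∀ i, IndepFun (X i) (fun ω => ∑ l ∈ s.erase i, X l ω) P := fun i => by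
      simpa [Finset.sum_fn] using
        (hind.indepFun_finsetSum_of_notMem₀ hmeas (Finset.notMem_erase i s)).symm
    have hsplit := fun i => integral_mul_add_pow (hrest i) (hX i) (integrable_sum_pow hX _) n
    have hpeel : ∀ ω, (∑ i ∈ s, X i ω) ^ (n + 1) =
        ∑ i ∈ s, X i ω * (X i ω + ∑ l ∈ s.erase i, X l ω) ^ n := fun ω => by
      rw [pow_succ', Finset.sum_mul]
      exact Finset.sum_congr rfl fun i hi => by rw [Finset.add_sum_erase s (fun l => X l ω) hi]
    simp only [hpeel]
    rw [integral_finsetSum _ fun i _ => (hsplit i).1,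
      sum_partitionTerm_succ (fun r => (s.card.descFactorial r : ℝ))]
    simp only [← mul_pred_descFactorial s.card]
    calc ∑ i ∈ s, ∫ ω, X i ω * (X i ω + ∑ l ∈ s.erase i, X l ω) ^ n ∂P
        = ∑ _i ∈ s, ∑ k ∈ Finset.range (n + 1), (n.choose k : ℝ) * μ (k + 1) *
            ∑ p : (n - k).Partition,
              ((s.card - 1).descFactorial p.parts.card : ℝ) * partitionTerm p μ := by
          refine Finset.sum_congr rfl fun i hi => ?_
          rw [(hsplit i).2]
          refine Finset.sum_congr rfl fun k _ => ?_
          rw [hμ, ih (n - k) (by omega), Finset.card_erase_of_mem hi]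
      _ = _ := by
          rw [Finset.sum_const, nsmul_eq_mul, Finset.mul_sum]
          refine Finset.sum_congr rfl fun k _ => ?_
          rw [mul_left_comm, Finset.mul_sum]
          exact congrArg _ (Finset.sum_congr rfl fun p _ => by push_cast; ring)

end IndependentSums

/-! ### The Bessel function of order zero -/

section Bessel

open Real (pi_pos pi_ne_zero)

lemma integral_cos_pow_odd (k : ℕ) : ∫ θ in (-Real.pi)..Real.pi, Real.cos θ ^ (2 * k + 1) = 0 := by
  induction k with
  | zero => simp
  | succ k ih =>
    rw [show 2 * (k + 1) + 1 = 2 * k + 1 + 2 by ring, integral_cos_pow, ih]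
    simp

lemma integral_cos_pow_even (k : ℕ) :
    ∫ θ in (-Real.pi)..Real.pi, Real.cos θ ^ (2 * k) =
      2 * Real.pi * (2 * k)! / (4 ^ k * (k ! : ℝ) ^ 2) := by
  induction k with
  | zero => simp; ring
  | succ k ih =>
    rw [show 2 * (k + 1) = 2 * k + 2 by ring, integral_cos_pow, ih]
    simp only [Nat.factorial_succ, Real.sin_pi, Real.sin_neg]
    push_cast
    field_simp
    ring

lemma hasSum_integral_cos_pow (x : ℝ) :
    HasSum (fun n : ℕ => x ^ n / n ! * ∫ θ in (-Real.pi)..Real.pi, Real.cos θ ^ n)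
      (∫ θ in (-Real.pi)..Real.pi, Real.exp (x * Real.cos θ)) := by
  have hterm : ∀ n : ℕ, x ^ n / n ! * ∫ θ in (-Real.pi)..Real.pi, Real.cos θ ^ n =
      ∫ θ in (-Real.pi)..Real.pi, (x * Real.cos θ) ^ n / (n ! : ℝ) := fun n => by
    rw [← intervalIntegral.integral_const_mul]
    exact intervalIntegral.integral_congr fun θ _ => by ring
  simp only [hterm]
  refine intervalIntegral.hasSum_integral_of_dominated_convergence (fun n _ => |x| ^ n / n !)
    (fun n => Continuous.aestronglyMeasurable (by fun_prop))
    (fun n => .of_forall fun θ _ => ?_)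
    (.of_forall fun θ _ => Real.summable_pow_div_factorial |x|) (by simp)
    (.of_forall fun θ _ => ?_)
  · rw [norm_div, norm_pow, norm_mul, Real.norm_eq_abs, Real.norm_eq_abs, Real.norm_natCast]
    gcongr
    exact mul_le_of_le_one_right (abs_nonneg _) (Real.abs_cos_le_one θ)
  · rw [Real.exp_eq_exp_ℝ]
    exact NormedSpace.expSeries_div_hasSum_exp (x * Real.cos θ)

lemma hasSum_besselI_zero (x : ℝ) :
    HasSum (fun k : ℕ => (x / 2) ^ (2 * k) / (k ! : ℝ) ^ 2)
      ((2 * Real.pi)⁻¹ * ∫ θ in (-Real.pi)..Real.pi, Real.exp (x * Real.cos θ)) := by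
  have hinj : Function.Injective fun k : ℕ => 2 * k := fun a b h => by simpa using h
  have heven := ((hinj.hasSum_iff fun n hn => ?_).2 (hasSum_integral_cos_pow x)).mul_left
    (2 * Real.pi)⁻¹
  · refine heven.congr_fun fun k => ?_
    simp only [Function.comp_apply]
    rw [integral_cos_pow_even, div_pow, pow_mul 2 2 k]
    have := pi_ne_zero
    norm_num
    field_simp
  · obtain ⟨k, rfl | rfl⟩ := Nat.even_or_odd' n
    · exact absurd ⟨k, rfl⟩ hn
    · simp [integral_cos_pow_odd]

lemma besselI_zero_eq_tsum (x : ℝ) :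
    besselI 0 x = ∑' k : ℕ, (x / 2) ^ (2 * k) / (k ! : ℝ) ^ 2 := by
  simp only [besselI, add_zero, sq]

lemma besselI_zero_eq_integral (x : ℝ) :
    besselI 0 x = (2 * Real.pi)⁻¹ * ∫ θ in (-Real.pi)..Real.pi, Real.exp (x * Real.cos θ) := by
  rw [besselI_zero_eq_tsum, (hasSum_besselI_zero x).tsum_eq]

lemma continuous_besselI_zero : Continuous (besselI 0) := by
  rw [funext besselI_zero_eq_integral]
  exact continuous_const.mul
    (intervalIntegral.continuous_parametric_intervalIntegral_of_continuous' (by fun_prop) _ _)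

lemma besselI_zero_pos (x : ℝ) : 0 < besselI 0 x := by
  rw [besselI_zero_eq_tsum]
  refine (hasSum_besselI_zero x).summable.tsum_pos (fun k => ?_) 0 (by simp)
  rw [pow_mul]
  positivity

lemma lintegral_exp_mul_cos_sub (x η : ℝ) :
    ∫⁻ θ in Set.Ioo (-Real.pi) Real.pi, ENNReal.ofReal (Real.exp (x * Real.cos (θ - η))) =
      ENNReal.ofReal (2 * Real.pi * besselI 0 x) := by
  have hcont : Continuous fun θ : ℝ => Real.exp (x * Real.cos (θ - η)) := by fun_prop
  have hperiod : Function.Periodic (fun θ => Real.exp (x * Real.cos θ)) (2 * Real.pi) := fun θ => by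
    simp
  have hshift := hperiod.intervalIntegral_add_eq (-Real.pi - η) (-Real.pi)
  rw [show -Real.pi - η + 2 * Real.pi = Real.pi - η by ring,
    show -Real.pi + 2 * Real.pi = Real.pi by ring] at hshift
  rw [Measure.restrict_congr_set Ioo_ae_eq_Ioc, ← ofReal_integral_eq_lintegral_ofReal
    hcont.integrableOn_Ioc (.of_forall fun θ => (Real.exp_pos _).le),
    ← intervalIntegral.integral_of_le (by linarith [pi_pos]),
    intervalIntegral.integral_comp_sub_right (fun θ => Real.exp (x * Real.cos θ)) η, hshift,
    besselI_zero_eq_integral, mul_inv_cancel_left₀ (mul_ne_zero two_ne_zero pi_ne_zero)]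

end Bessel

/-! ### The modulus of a complex Gaussian variable -/

section ComplexGaussian

instance isProbabilityMeasure_complexGaussian (v : ℝ) :
    IsProbabilityMeasure (complexGaussian v) :=
  Measure.isProbabilityMeasure_map Complex.measurableEquivRealProd.symm.measurable.aemeasurable

lemma gaussianPDF_mul_gaussianPDF {v : ℝ} (hv : 0 < v) (x y : ℝ) :
    gaussianPDF 0 (v / 2).toNNReal x * gaussianPDF 0 (v / 2).toNNReal y =
      ENNReal.ofReal ((Real.pi * v)⁻¹ * Real.exp (-‖(⟨x, y⟩ : ℂ)‖ ^ 2 / v)) := by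
  rw [gaussianPDF, gaussianPDF, ← ENNReal.ofReal_mul (gaussianPDFReal_nonneg _ _ _),
    Complex.sq_norm, Complex.normSq_mk, gaussianPDFReal, gaussianPDFReal,
    Real.coe_toNNReal _ (by positivity)]
  congr 1
  have hsqrt : √(2 * Real.pi * (v / 2)) * √(2 * Real.pi * (v / 2)) = Real.pi * v := by
    rw [Real.mul_self_sqrt (by positivity)]; ring
  rw [mul_mul_mul_comm, ← mul_inv, hsqrt, ← Real.exp_add]
  congr 2
  field_simp
  ring

lemma lintegral_complexGaussian {v : ℝ} (hv : 0 < v) {f : ℂ → ENNReal} (hf : Measurable f) :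
    ∫⁻ z, f z ∂complexGaussian v =
      ∫⁻ z, ENNReal.ofReal ((Real.pi * v)⁻¹ * Real.exp (-‖z‖ ^ 2 / v)) * f z := by
  have hvar : (v / 2).toNNReal ≠ 0 := by simpa using hv
  have hmk : Measurable fun q : ℝ × ℝ => (⟨q.1, q.2⟩ : ℂ) :=
    Complex.measurableEquivRealProd.symm.measurable
  rw [complexGaussian, lintegral_map hf hmk, gaussianReal_of_var_ne_zero _ hvar,
    prod_withDensity (measurable_gaussianPDF _ _) (measurable_gaussianPDF _ _),
    lintegral_withDensity_eq_lintegral_mul _ (by fun_prop) (g := fun q : ℝ × ℝ => f ⟨q.1, q.2⟩)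
      (hf.comp hmk), ← Complex.volume_preserving_equiv_real_prod.symm.lintegral_comp_emb
      Complex.measurableEquivRealProd.symm.measurableEmbedding]
  exact lintegral_congr fun q => congrArg (· * _) (gaussianPDF_mul_gaussianPDF hv q.1 q.2)

lemma lintegral_norm_add_complexGaussian_eq_volume {v : ℝ} (hv : 0 < v) (a : ℂ)
    {f : ℝ → ENNReal} (hf : Measurable f) :
    ∫⁻ z, f ‖z + a‖ ∂complexGaussian v =
      ∫⁻ w : ℂ, ENNReal.ofReal ((Real.pi * v)⁻¹ * Real.exp (-‖w - a‖ ^ 2 / v)) * f ‖w‖ := by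
  rw [lintegral_complexGaussian hv (f := fun z => f ‖z + a‖) (hf.comp (by fun_prop)),
    ← lintegral_add_right_eq_self (μ := volume) (fun w : ℂ => ENNReal.ofReal
      ((Real.pi * v)⁻¹ * Real.exp (-‖w - a‖ ^ 2 / v)) * f ‖w‖) a]
  simp only [add_sub_cancel_right]

lemma norm_polar_sub_sq (r θ : ℝ) (a : ℂ) :
    ‖(r * (Real.cos θ + Real.sin θ * Complex.I) : ℂ) - a‖ ^ 2 =
      r ^ 2 + ‖a‖ ^ 2 - 2 * ‖a‖ * r * Real.cos (θ - Complex.arg a) := by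
  have hre : ((r * (Real.cos θ + Real.sin θ * Complex.I) : ℂ) - a).re = r * Real.cos θ - a.re := by
    simp [-Complex.ofReal_cos, -Complex.ofReal_sin]
  have him : ((r * (Real.cos θ + Real.sin θ * Complex.I) : ℂ) - a).im = r * Real.sin θ - a.im := by
    simp [-Complex.ofReal_cos, -Complex.ofReal_sin]
  rw [Complex.sq_norm, Complex.normSq_apply, hre, him, Real.cos_sub, Complex.sq_norm,
    Complex.normSq_apply a]
  linear_combination r ^ 2 * Real.sin_sq_add_cos_sq θ +
    2 * r * Real.cos θ * Complex.norm_mul_cos_arg a +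
    2 * r * Real.sin θ * Complex.norm_mul_sin_arg a

/-- The Rice density: the angular integral in polar coordinates is a Bessel function. -/
theorem lintegral_norm_add_complexGaussian {v : ℝ} (hv : 0 < v) (a : ℂ) {f : ℝ → ENNReal}
    (hf : Measurable f) :
    ∫⁻ z, f ‖z + a‖ ∂complexGaussian v = ∫⁻ r in Set.Ioi 0, f r * ENNReal.ofReal
      (2 * r / v * Real.exp (-(r ^ 2 + ‖a‖ ^ 2) / v) * besselI 0 (2 * ‖a‖ * r / v)) := by
  rw [lintegral_norm_add_complexGaussian_eq_volume hv a hf,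
    ← Complex.lintegral_comp_polarCoord_symm]
  simp only [Complex.norm_polarCoord_symm]
  simp only [Complex.polarCoord_symm_apply, norm_polar_sub_sq, smul_eq_mul, polarCoord_target]
  rw [Measure.volume_eq_prod, ← Measure.prod_restrict, lintegral_prod _ (by fun_prop)]
  refine setLIntegral_congr_fun measurableSet_Ioi fun r (hr : 0 < r) => ?_
  have hsplit : ∀ θ : ℝ, ENNReal.ofReal r * (ENNReal.ofReal ((Real.pi * v)⁻¹ * Real.exp
      (-(r ^ 2 + ‖a‖ ^ 2 - 2 * ‖a‖ * r * Real.cos (θ - Complex.arg a)) / v)) * f r) =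
      f r * (ENNReal.ofReal (r * ((Real.pi * v)⁻¹ * Real.exp (-(r ^ 2 + ‖a‖ ^ 2) / v))) *
        ENNReal.ofReal (Real.exp ((2 * ‖a‖ * r / v) * Real.cos (θ - Complex.arg a)))) := fun θ => by
    rw [← ENNReal.ofReal_mul (by positivity), ← mul_assoc, ← ENNReal.ofReal_mul hr.le, mul_comm,
      mul_assoc r, mul_assoc _ (Real.exp _), ← Real.exp_add]
    congr 5
    ring
  simp only [abs_of_pos hr, hsplit]
  rw [lintegral_const_mul _ (by fun_prop), lintegral_const_mul _ (by fun_prop),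
    lintegral_exp_mul_cos_sub, ← ENNReal.ofReal_mul (by positivity)]
  congr 2
  have := Real.pi_ne_zero
  field_simp

end ComplexGaussian

/-! ### Kummer's transformation -/

section Kummer

lemma descPochhammer_smeval_eq_eval (n : ℕ) (x : ℝ) :
    (descPochhammer ℤ n).smeval x = (descPochhammer ℝ n).eval x := by
  rw [← descPochhammer_map (algebraMap ℤ ℝ), Polynomial.eval_map, ← Polynomial.aeval_def,
    Polynomial.aeval_eq_smeval]

/-- The Chu–Vandermonde identity for the falling factorials of `n + -(1 + k)`. -/
lemma sum_choose_mul_ascPochhammer (k : ℝ) (n : ℕ) :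
    ∑ ij ∈ Finset.HasAntidiagonal.antidiagonal n, (n.choose ij.1 : ℝ) * (((n ! : ℝ) / (ij.2)!) *
      ((-1) ^ ij.2 * (ascPochhammer ℝ ij.2).eval (1 + k))) = (ascPochhammer ℝ n).eval (-k) := by
  have vandermonde := Ring.descPochhammer_smeval_add (r := (n : ℝ)) (s := -(1 + k)) n
    (Commute.all _ _)
  rw [descPochhammer_smeval_eq_eval, descPochhammer_eval_eq_ascPochhammer,
    show (n : ℝ) + -(1 + k) - n + 1 = -k by ring] at vandermonde
  rw [vandermonde]
  refine Finset.sum_congr rfl fun ij hij => ?_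
  rw [Finset.HasAntidiagonal.mem_antidiagonal] at hij
  have hdesc : (n.descFactorial ij.1 : ℝ) = (n ! : ℝ) / (ij.2)! := by
    rw [eq_div_iff (by positivity), mul_comm, ← hij]
    exact_mod_cast Nat.add_sub_cancel_left (n := ij.1) (m := ij.2) ▸
      Nat.factorial_mul_descFactorial (Nat.le_add_right ij.1 ij.2)
  have hneg := ascPochhammer_eval_neg_eq_descPochhammer ℝ (-(1 + k)) ij.2
  rw [neg_neg] at hneg
  rw [Polynomial.descPochhammer_smeval_eq_descFactorial, descPochhammer_smeval_eq_eval, hdesc,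
    hneg, ← mul_assoc ((-1 : ℝ) ^ _), ← mul_pow, neg_one_mul, neg_neg, one_pow, one_mul]

lemma ascPochhammer_eval_one_add_nonneg {k : ℝ} (hk : 0 ≤ k) (n : ℕ) :
    0 ≤ (ascPochhammer ℝ n).eval (1 + k) := (ascPochhammer_pos n _ (by linarith)).le

lemma ascPochhammer_eval_one_add_le {k : ℝ} (hk : 0 ≤ k) (n : ℕ) :
    (ascPochhammer ℝ n).eval (1 + k) ≤ n ! * (1 + k) ^ n := by
  induction n with
  | zero => simp
  | succ n ih =>
    rw [ascPochhammer_succ_eval, Nat.factorial_succ, pow_succ]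
    push_cast
    calc (ascPochhammer ℝ n).eval (1 + k) * (1 + k + n)
        ≤ (n ! * (1 + k) ^ n) * ((n + 1) * (1 + k)) := by
          gcongr
          nlinarith [mul_nonneg hk (Nat.cast_nonneg (α := ℝ) n)]
      _ = (n + 1) * n ! * ((1 + k) ^ n * (1 + k)) := by ring

lemma summable_norm_kummer {k : ℝ} (hk : 0 ≤ k) (x : ℝ) :
    Summable fun n : ℕ => ‖(ascPochhammer ℝ n).eval (1 + k) / (n ! : ℝ) ^ 2 * x ^ n‖ := by
  refine Summable.of_nonneg_of_le (fun _ => norm_nonneg _) (fun n => ?_)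
    (Real.summable_pow_div_factorial ((1 + k) * |x|))
  rw [norm_mul, norm_div, norm_pow, norm_pow, Real.norm_natCast, Real.norm_eq_abs x,
    Real.norm_of_nonneg (ascPochhammer_eval_one_add_nonneg hk n)]
  calc (ascPochhammer ℝ n).eval (1 + k) / (n ! : ℝ) ^ 2 * |x| ^ n
      ≤ (n ! * (1 + k) ^ n) / (n ! : ℝ) ^ 2 * |x| ^ n := by
        gcongr
        exact ascPochhammer_eval_one_add_le hk n
    _ = ((1 + k) * |x|) ^ n / n ! := by
      have : (n ! : ℝ) ≠ 0 := by positivity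
      rw [mul_pow]
      field_simp

/-- Kummer's transformation `e^{-x} ₁F₁(1+k; 1; x) = ₁F₁(-k; 1; -x)`. -/
theorem exp_neg_mul_tsum_eq_laguerreFn {k : ℝ} (hk : 0 ≤ k) (x : ℝ) :
    Real.exp (-x) * ∑' n : ℕ, (ascPochhammer ℝ n).eval (1 + k) / (n ! : ℝ) ^ 2 * x ^ n =
      laguerreFn k (-x) := by
  rw [Real.exp_eq_exp_ℝ, NormedSpace.exp_eq_tsum_div,
    tsum_mul_tsum_eq_tsum_sum_antidiagonal_of_summable_norm
      (Real.summable_pow_div_factorial (-x)).norm (summable_norm_kummer hk x), laguerreFn]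
  refine tsum_congr fun n => ?_
  rw [← sum_choose_mul_ascPochhammer, Finset.sum_div, Finset.sum_mul]
  refine Finset.sum_congr rfl fun ij hij => ?_
  obtain ⟨i, j⟩ := ij
  obtain rfl : i + j = n := Finset.HasAntidiagonal.mem_antidiagonal.1 hij
  simp only
  rw [Nat.cast_choose ℝ (Nat.le_add_right i j), Nat.add_sub_cancel_left, neg_pow x i,
    neg_pow x (i + j), pow_add, pow_add]
  have hi : (i ! : ℝ) ≠ 0 := by positivity
  have hj : (j ! : ℝ) ≠ 0 := by positivity
  have hij' : ((i + j)! : ℝ) ≠ 0 := by positivity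
  have hsign : ((-1 : ℝ) ^ j) * (-1) ^ j = 1 := by rw [← mul_pow]; norm_num
  field_simp
  linear_combination (-(x ^ i * x ^ j * (ascPochhammer ℝ j).eval (1 + k))) * hsign

lemma Gamma_add_natCast {a : ℝ} (ha : 0 < a) (n : ℕ) :
    Real.Gamma (a + n) = Real.Gamma a * (ascPochhammer ℝ n).eval a := by
  induction n with
  | zero => simp
  | succ n ih =>
    rw [ascPochhammer_succ_eval, ← mul_assoc, ← ih, Nat.cast_succ, ← add_assoc,
      Real.Gamma_add_one (by positivity), mul_comm]

end Kummer

/-! ### Gamma laws -/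

section Gamma

lemma lintegral_Ioi_comp_sq (g : ℝ → ENNReal) :
    ∫⁻ y in Set.Ioi 0, g y = ∫⁻ r in Set.Ioi (0 : ℝ), ENNReal.ofReal (2 * r) * g (r ^ 2) := by
  have himage : (fun r : ℝ => r ^ 2) '' Set.Ioi 0 = Set.Ioi 0 :=
    Set.Subset.antisymm (Set.image_subset_iff.2 fun r hr => pow_pos (Set.mem_Ioi.1 hr) 2)
      fun y hy => ⟨√y, Real.sqrt_pos.2 hy, Real.sq_sqrt (le_of_lt hy)⟩
  have hinj : Set.InjOn (fun r : ℝ => r ^ 2) (Set.Ioi 0) := fun x hx y hy h =>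
    (pow_left_inj₀ (le_of_lt hx) (le_of_lt hy) two_ne_zero).1 h
  have hsubst := lintegral_image_eq_lintegral_abs_deriv_mul measurableSet_Ioi
    (f' := fun r => 2 * r)
    (fun r _ => by simpa using (hasDerivAt_pow 2 r).hasDerivWithinAt) hinj g
  rw [himage] at hsubst
  rw [hsubst]
  refine setLIntegral_congr_fun measurableSet_Ioi fun r (hr : 0 < r) => ?_
  rw [abs_of_pos (by positivity)]

lemma lintegral_Ioi_comp_const_mul {c : ℝ} (hc : 0 < c) (g : ℝ → ENNReal) :
    ∫⁻ y in Set.Ioi 0, g y = ∫⁻ r in Set.Ioi (0 : ℝ), ENNReal.ofReal c * g (c * r) := by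
  have hsubst := lintegral_image_eq_lintegral_abs_deriv_mul (s := Set.Ioi (0 : ℝ))
    (f := fun r => c * r) (f' := fun _ => c) measurableSet_Ioi
    (fun r _ => by simpa using ((hasDerivAt_id r).const_mul c).hasDerivWithinAt)
    (fun x _ y _ h => mul_left_cancel₀ hc.ne' h) g
  rwa [Set.image_mul_left_Ioi hc, mul_zero, abs_of_pos hc] at hsubst

lemma lintegral_gammaMeasure (a r : ℝ) {f : ℝ → ENNReal} (hf : Measurable f) :
    ∫⁻ x, f x ∂gammaMeasure a r = ∫⁻ x in Set.Ioi 0,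
      ENNReal.ofReal (r ^ a / Real.Gamma a * x ^ (a - 1) * Real.exp (-(r * x))) * f x := by
  have hm : Measurable (gammaPDF a r) := (measurable_gammaPDFReal a r).ennreal_ofReal
  rw [gammaMeasure, lintegral_withDensity_eq_lintegral_mul _ hm hf,
    ← lintegral_add_compl _ measurableSet_Ici, Set.compl_Ici,
    setLIntegral_congr_fun (g := fun _ => 0) measurableSet_Iio
      (fun x (hx : x < 0) => by rw [Pi.mul_apply, gammaPDF_of_neg hx, zero_mul]),
    lintegral_zero, add_zero, Measure.restrict_congr_set Ioi_ae_eq_Ici.symm]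
  refine setLIntegral_congr_fun measurableSet_Ioi fun x hx => ?_
  rw [Pi.mul_apply, gammaPDF_of_nonneg (le_of_lt hx)]

lemma lintegral_comp_div_gammaMeasure (a : ℝ) {r c : ℝ} (hr : 0 ≤ r) (hc : 0 < c)
    {f : ℝ → ENNReal} (hf : Measurable f) :
    ∫⁻ x, f (x / c) ∂gammaMeasure a r = ∫⁻ x, f x ∂gammaMeasure a (r * c) := by
  rw [lintegral_gammaMeasure _ _ (f := fun x => f (x / c)) (hf.comp (by fun_prop)),
    lintegral_gammaMeasure _ _ hf, lintegral_Ioi_comp_const_mul hc]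
  refine setLIntegral_congr_fun measurableSet_Ioi fun x (hx : 0 < x) => ?_
  rw [mul_div_cancel_left₀ x hc.ne', ← mul_assoc, ← ENNReal.ofReal_mul hc.le,
    Real.mul_rpow hr hc.le, Real.mul_rpow hc.le hx.le, Real.rpow_sub_one hc.ne' a]
  congr 2
  field_simp

lemma lintegral_Ioi_gamma_density {a r : ℝ} (ha : 0 < a) (hr : 0 < r) :
    ∫⁻ x in Set.Ioi 0, ENNReal.ofReal (r ^ a / Real.Gamma a * x ^ (a - 1) * Real.exp (-(r * x))) =
      1 := by
  have := isProbabilityMeasure_gammaMeasure ha hr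
  simpa using (lintegral_gammaMeasure a r (f := fun _ => 1) measurable_const).symm

lemma lintegral_rpow_gammaMeasure {a r k : ℝ} (ha : 0 < a) (hr : 0 < r) (hk : 0 ≤ k) :
    ∫⁻ x, ENNReal.ofReal (x ^ k) ∂gammaMeasure a r =
      ENNReal.ofReal (Real.Gamma (a + k) / (Real.Gamma a * r ^ k)) := by
  have hak : 0 < a + k := by linarith
  have := Real.Gamma_pos_of_pos ha
  have := Real.Gamma_pos_of_pos hak
  rw [lintegral_gammaMeasure a r (by fun_prop), ← mul_one (ENNReal.ofReal (_ / _)),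
    ← lintegral_Ioi_gamma_density hak hr, ← lintegral_const_mul _ (by fun_prop)]
  refine setLIntegral_congr_fun measurableSet_Ioi fun x (hx : 0 < x) => ?_
  have := Real.rpow_pos_of_pos hr k
  rw [← ENNReal.ofReal_mul (by positivity), ← ENNReal.ofReal_mul (by positivity)]
  congr 1
  rw [show a + k - 1 = (a - 1) + k by ring, Real.rpow_add hx, Real.rpow_add hr]
  field_simp

lemma lintegral_exp_neg_mul_gammaMeasure {a r s : ℝ} (ha : 0 < a) (hr : 0 < r) (hs : 0 ≤ s) :
    ∫⁻ x, ENNReal.ofReal (Real.exp (-s * x)) ∂gammaMeasure a r =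
      ENNReal.ofReal ((r / (r + s)) ^ a) := by
  have hrs : 0 < r + s := by linarith
  have := Real.Gamma_pos_of_pos ha
  rw [lintegral_gammaMeasure a r (by fun_prop), ← mul_one (ENNReal.ofReal (_ ^ _)),
    ← lintegral_Ioi_gamma_density ha hrs, ← lintegral_const_mul _ (by fun_prop)]
  refine setLIntegral_congr_fun measurableSet_Ioi fun x (hx : 0 < x) => ?_
  have := Real.rpow_pos_of_pos hrs a
  rw [← ENNReal.ofReal_mul (by positivity), ← ENNReal.ofReal_mul (by positivity)]
  congr 1
  rw [Real.div_rpow hr.le hrs.le, show -((r + s) * x) = -(r * x) + -s * x by ring, Real.exp_add]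
  field_simp

end Gamma

/-! ### Poisson mixtures of Gamma laws -/

section PoissonMixture

/-- The Poisson weight of `n` at rate `x`, the mixing weight of the squared modulus of a complex
Gaussian variable with nonzero mean. -/
noncomputable def poissonWeight (x : ℝ) (n : ℕ) : ℝ := Real.exp (-x) * x ^ n / n !

lemma poissonWeight_nonneg {x : ℝ} (hx : 0 ≤ x) (n : ℕ) : 0 ≤ poissonWeight x n := by
  rw [poissonWeight]
  positivity

lemma hasSum_poissonWeight_mul_pow (x q : ℝ) :
    HasSum (fun n => poissonWeight x n * q ^ n) (Real.exp (-x + x * q)) := by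
  have hexp := NormedSpace.expSeries_div_hasSum_exp (x * q)
  rw [← Real.exp_eq_exp_ℝ] at hexp
  rw [Real.exp_add]
  refine (hexp.mul_left (Real.exp (-x))).congr_fun fun n => ?_
  rw [poissonWeight, mul_pow]
  ring

lemma tsum_ofReal_mul_ofReal {ι : Type*} {w c : ι → ℝ} {x : ℝ} (hw : ∀ n, 0 ≤ w n)
    (hc : ∀ n, 0 ≤ c n) (h : HasSum (fun n => w n * c n) x) :
    ∑' n, ENNReal.ofReal (w n) * ENNReal.ofReal (c n) = ENNReal.ofReal x := by
  rw [← h.tsum_eq, ENNReal.ofReal_tsum_of_nonneg (fun n => mul_nonneg (hw n) (hc n)) h.summable]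
  exact tsum_congr fun n => (ENNReal.ofReal_mul (hw n)).symm

lemma tsum_poissonWeight_mul_lintegral_exp {x r s : ℝ} (hx : 0 ≤ x) (hr : 0 < r) (hs : 0 ≤ s) :
    ∑' n : ℕ, ENNReal.ofReal (poissonWeight x n) *
      ∫⁻ y, ENNReal.ofReal (Real.exp (-s * y)) ∂gammaMeasure (n + 1) r =
      ENNReal.ofReal (System.riceLaplace x r⁻¹ s) := by
  have hgamma : ∀ n : ℕ, ∫⁻ y, ENNReal.ofReal (Real.exp (-s * y)) ∂gammaMeasure (n + 1) r =
      ENNReal.ofReal ((1 + r⁻¹ * s)⁻¹ ^ n * (1 + r⁻¹ * s)⁻¹) := fun n => by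
    rw [lintegral_exp_neg_mul_gammaMeasure (by positivity) hr hs, ← Nat.cast_succ,
      Real.rpow_natCast, ← pow_succ]
    congr 2
    field_simp
  simp only [hgamma]
  refine tsum_ofReal_mul_ofReal (poissonWeight_nonneg hx) (fun n => by positivity) ?_
  rw [System.riceLaplace, div_eq_mul_inv _ (1 + r⁻¹ * s), div_eq_mul_inv x]
  exact ((hasSum_poissonWeight_mul_pow x _).mul_right _).congr_fun fun n => by ring

lemma tsum_poissonWeight_mul_lintegral_rpow {K k : ℝ} (hK : 0 ≤ K) (hk : 0 ≤ k) :
    ∑' n : ℕ, ENNReal.ofReal (poissonWeight K n) *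
      ∫⁻ y, ENNReal.ofReal (y ^ k) ∂gammaMeasure (n + 1) (K + 1) =
      ENNReal.ofReal (System.momRice K k) := by
  have hK1 : 0 < K + 1 := by linarith
  have : 0 < Real.Gamma (1 + k) := Real.Gamma_pos_of_pos (by linarith)
  have hgamma : ∀ n : ℕ, ∫⁻ y, ENNReal.ofReal (y ^ k) ∂gammaMeasure (n + 1) (K + 1) =
      ENNReal.ofReal (Real.Gamma (1 + k) * (ascPochhammer ℝ n).eval (1 + k) /
        (n ! * (K + 1) ^ k)) := fun n => by
    rw [lintegral_rpow_gammaMeasure (by positivity) hK1 hk, add_assoc, add_comm (n : ℝ),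
      Gamma_add_natCast (show 0 < 1 + k by linarith), Real.Gamma_nat_eq_factorial]
  simp only [hgamma]
  refine tsum_ofReal_mul_ofReal (poissonWeight_nonneg hK) (fun n => ?_) ?_
  · have := ascPochhammer_eval_one_add_nonneg hk n
    positivity
  · have hsum := ((summable_norm_kummer hk K).of_norm.hasSum.mul_left (Real.exp (-K))).mul_left
      (Real.Gamma (1 + k) / (1 + K) ^ k)
    rw [exp_neg_mul_tsum_eq_laguerreFn hk, div_mul_eq_mul_div, ← System.momRice] at hsum
    refine hsum.congr_fun fun n => ?_
    have := Real.rpow_pos_of_pos hK1 k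
    rw [poissonWeight, add_comm 1 K]
    field_simp

lemma poissonWeight_mul_gamma_density {v : ℝ} (hv : v ≠ 0) (a r : ℝ) (n : ℕ) :
    poissonWeight (a ^ 2 / v) n * (2 * r * ((1 / v) ^ ((n : ℝ) + 1) / Real.Gamma (n + 1) *
      (r ^ 2) ^ ((n : ℝ) + 1 - 1) * Real.exp (-(1 / v * r ^ 2)))) =
      2 * r / v * Real.exp (-(r ^ 2 + a ^ 2) / v) *
        ((2 * a * r / v / 2) ^ (2 * n) / (n ! : ℝ) ^ 2) := by
  rw [Real.Gamma_nat_eq_factorial, add_sub_cancel_right, Real.rpow_natCast, ← Nat.cast_succ,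
    Real.rpow_natCast, pow_succ (1 / v), poissonWeight, pow_mul,
    show -(r ^ 2 + a ^ 2) / v = -(a ^ 2 / v) + -(1 / v * r ^ 2) by ring, Real.exp_add,
    show (2 * a * r / v / 2) ^ 2 = (a ^ 2 / v) * (1 / v) * r ^ 2 by field_simp, mul_pow, mul_pow]
  have hn : (n ! : ℝ) ≠ 0 := by positivity
  field_simp

theorem lintegral_sq_norm_add_complexGaussian {v : ℝ} (hv : 0 < v) (a : ℂ) {f : ℝ → ENNReal}
    (hf : Measurable f) :
    ∫⁻ z, f (‖z + a‖ ^ 2) ∂complexGaussian v =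
      ∑' n : ℕ, ENNReal.ofReal (poissonWeight (‖a‖ ^ 2 / v) n) *
        ∫⁻ y, f y ∂gammaMeasure (n + 1) (1 / v) := by
  rw [lintegral_norm_add_complexGaussian hv a (f := fun r => f (r ^ 2)) (hf.comp (by fun_prop))]
  have hgamma : ∀ n : ℕ, ENNReal.ofReal (poissonWeight (‖a‖ ^ 2 / v) n) *
      ∫⁻ y, f y ∂gammaMeasure (n + 1) (1 / v) = ∫⁻ r in Set.Ioi (0 : ℝ),
        ENNReal.ofReal (poissonWeight (‖a‖ ^ 2 / v) n) * (ENNReal.ofReal (2 * r) *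
          (ENNReal.ofReal ((1 / v) ^ ((n : ℝ) + 1) / Real.Gamma (n + 1) *
            (r ^ 2) ^ ((n : ℝ) + 1 - 1) * Real.exp (-(1 / v * r ^ 2))) * f (r ^ 2))) := fun n => by
    rw [lintegral_gammaMeasure _ _ hf, lintegral_Ioi_comp_sq, ← lintegral_const_mul _ (by fun_prop)]
  simp only [hgamma]
  rw [← lintegral_tsum fun n => (by fun_prop)]
  refine setLIntegral_congr_fun measurableSet_Ioi fun r (hr : 0 < r) => ?_
  have hterm : ∀ n : ℕ, ENNReal.ofReal (poissonWeight (‖a‖ ^ 2 / v) n) * (ENNReal.ofReal (2 * r) *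
      (ENNReal.ofReal ((1 / v) ^ ((n : ℝ) + 1) / Real.Gamma (n + 1) *
        (r ^ 2) ^ ((n : ℝ) + 1 - 1) * Real.exp (-(1 / v * r ^ 2))) * f (r ^ 2))) =
      f (r ^ 2) * ENNReal.ofReal (2 * r / v * Real.exp (-(r ^ 2 + ‖a‖ ^ 2) / v) *
        ((2 * ‖a‖ * r / v / 2) ^ (2 * n) / (n ! : ℝ) ^ 2)) := fun n => by
    rw [← poissonWeight_mul_gamma_density hv.ne', ENNReal.ofReal_mul
      (poissonWeight_nonneg (by positivity) n), ENNReal.ofReal_mul (p := 2 * r) (by positivity)]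
    ring
  simp only [hterm]
  rw [ENNReal.tsum_mul_left, besselI_zero_eq_tsum, ← tsum_mul_left, ENNReal.ofReal_tsum_of_nonneg
    (fun n => by rw [pow_mul]; positivity) ((hasSum_besselI_zero _).summable.mul_left _)]

theorem lintegral_exp_neg_sq_norm_add_complexGaussian {v s : ℝ} (hv : 0 < v) (hs : 0 ≤ s) (a : ℂ) :
    ∫⁻ z, ENNReal.ofReal (Real.exp (-s * ‖z + a‖ ^ 2)) ∂complexGaussian v =
      ENNReal.ofReal (System.riceLaplace (‖a‖ ^ 2 / v) v s) := by
  rw [lintegral_sq_norm_add_complexGaussian hv a (f := fun y => ENNReal.ofReal (Real.exp (-s * y)))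
    (by fun_prop), tsum_poissonWeight_mul_lintegral_exp (by positivity) (by positivity) hs, one_div,
    inv_inv]

end PoissonMixture

/-! ### Rician coefficients -/

section Rician

variable {K : ℝ} {u : ℂ}

lemma measurable_ricianFading_map (K : ℝ) (u : ℂ) :
    Measurable fun z : ℂ => ((√K : ℝ) * u + z) / ((√(K + 1) : ℝ) : ℂ) := by fun_prop

instance isProbabilityMeasure_ricianFading (K : ℝ) (u : ℂ) :
    IsProbabilityMeasure (ricianFading K u) :=
  Measure.isProbabilityMeasure_map (measurable_ricianFading_map K u).aemeasurable

lemma lintegral_norm_ricianFading (K : ℝ) (u : ℂ) {f : ℝ → ENNReal} (hf : Measurable f) :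
    ∫⁻ z, f ‖z‖ ∂ricianFading K u =
      ∫⁻ z, f (‖z + (√K : ℝ) * u‖ / √(K + 1)) ∂complexGaussian 1 := by
  rw [ricianFading, lintegral_map (f := fun z : ℂ => f ‖z‖) (hf.comp measurable_norm)
    (measurable_ricianFading_map K u)]
  refine lintegral_congr fun z => ?_
  rw [norm_div, Complex.norm_real, Real.norm_of_nonneg (Real.sqrt_nonneg _), add_comm]

lemma norm_sqrt_mul (K : ℝ) (hu : ‖u‖ = 1) : ‖((√K : ℝ) : ℂ) * u‖ = √K := by
  rw [norm_mul, hu, mul_one, Complex.norm_real, Real.norm_of_nonneg (Real.sqrt_nonneg _)]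

lemma lintegral_sq_norm_ricianFading (hK : 0 ≤ K) (hu : ‖u‖ = 1) {f : ℝ → ENNReal}
    (hf : Measurable f) :
    ∫⁻ z, f (‖z‖ ^ 2) ∂ricianFading K u = ∑' n : ℕ, ENNReal.ofReal (poissonWeight K n) *
      ∫⁻ y, f y ∂gammaMeasure (n + 1) (K + 1) := by
  have hK1 : 0 < K + 1 := by linarith
  rw [lintegral_norm_ricianFading K u (f := fun r => f (r ^ 2)) (hf.comp (by fun_prop))]
  simp only [div_pow, Real.sq_sqrt hK1.le]
  rw [lintegral_sq_norm_add_complexGaussian one_pos _ (f := fun y => f (y / (K + 1)))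
    (hf.comp (by fun_prop)), norm_sqrt_mul K hu, Real.sq_sqrt hK, div_one, div_one]
  simp only [lintegral_comp_div_gammaMeasure _ zero_le_one hK1 hf, one_mul]

theorem lintegral_rpow_ricianFading {k : ℝ} (hK : 0 ≤ K) (hk : 0 ≤ k) (hu : ‖u‖ = 1) :
    ∫⁻ z, ENNReal.ofReal ((‖z‖ ^ 2) ^ k) ∂ricianFading K u =
      ENNReal.ofReal (System.momRice K k) := by
  rw [lintegral_sq_norm_ricianFading hK hu (f := fun y => ENNReal.ofReal (y ^ k)) (by fun_prop),
    tsum_poissonWeight_mul_lintegral_rpow hK hk]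

theorem lintegral_exp_neg_sq_norm_ricianFading {c s : ℝ} (hK : 0 ≤ K) (hc : 0 ≤ c) (hs : 0 ≤ s)
    (hu : ‖u‖ = 1) :
    ∫⁻ z, ENNReal.ofReal (Real.exp (-s * (c * ‖z‖ ^ 2))) ∂ricianFading K u =
      ENNReal.ofReal (System.riceLaplace K (c / (K + 1)) s) := by
  simp only [← mul_assoc]
  rw [lintegral_sq_norm_ricianFading hK hu
      (f := fun y => ENNReal.ofReal (Real.exp (-s * c * y))) (by fun_prop), neg_mul,
    tsum_poissonWeight_mul_lintegral_exp hK (by linarith) (mul_nonneg hs hc), System.riceLaplace,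
    System.riceLaplace, show (K + 1)⁻¹ * (s * c) = c / (K + 1) * s by ring]

lemma lintegral_sqrt_mul_norm_ricianFading (hK : 0 ≤ K) (hu : ‖u‖ = 1) {g : ℝ → ENNReal}
    (hg : Measurable g) :
    ∫⁻ z, g (√(2 * (K + 1)) * ‖z‖) ∂ricianFading K u =
      ∫⁻ t in Set.Ioi 0, g t * ENNReal.ofReal
        (t * Real.exp (-(t ^ 2 + √(2 * K) ^ 2) / 2) * besselI 0 (√(2 * K) * t)) := by
  have : 0 < √(K + 1) := Real.sqrt_pos.2 (by linarith)
  have hscale : ∀ x : ℝ, √(2 * (K + 1)) * (x / √(K + 1)) = √2 * x := fun x => by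
    rw [Real.sqrt_mul zero_le_two]
    field_simp
  rw [lintegral_norm_ricianFading K u (f := fun r => g (√(2 * (K + 1)) * r))
    (hg.comp (by fun_prop))]
  simp only [hscale]
  rw [lintegral_norm_add_complexGaussian one_pos _ (f := fun r => g (√2 * r))
    (hg.comp (by fun_prop)), norm_sqrt_mul K hu, Real.sq_sqrt hK,
    lintegral_Ioi_comp_const_mul (Real.sqrt_pos.2 two_pos) fun t => g t * ENNReal.ofReal
      (t * Real.exp (-(t ^ 2 + √(2 * K) ^ 2) / 2) * besselI 0 (√(2 * K) * t))]
  refine setLIntegral_congr_fun measurableSet_Ioi fun r _ => ?_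
  have hsq : √2 * √2 = (2 : ℝ) := Real.mul_self_sqrt zero_le_two
  rw [mul_left_comm, ← ENNReal.ofReal_mul (Real.sqrt_nonneg 2), Real.sq_sqrt (by positivity),
    mul_pow √2 r, Real.sq_sqrt zero_le_two, Real.sqrt_mul zero_le_two,
    show √2 * √K * (√2 * r) = 2 * √K * r / 1 by linear_combination √K * r * hsq,
    show -(2 * r ^ 2 + 2 * K) / 2 = -(r ^ 2 + K) / 1 by ring]
  congr 2
  linear_combination (-(r * Real.exp (-(r ^ 2 + K) / 1) * besselI 0 (2 * √K * r / 1))) * hsq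

theorem lintegral_indicator_norm_pow_ricianFading {b : ℝ} (hK : 0 ≤ K) (hb : 0 ≤ b)
    (hu : ‖u‖ = 1) (i : ℕ) :
    ∫⁻ z, (Set.Ici b).indicator (fun t => ENNReal.ofReal (t ^ i)) (√(2 * (K + 1)) * ‖z‖)
      ∂ricianFading K u =
      ∫⁻ t in Set.Ioi b, ENNReal.ofReal
        (t ^ (i + 1) * Real.exp (-(t ^ 2 + √(2 * K) ^ 2) / 2) * besselI 0 (√(2 * K) * t)) := by
  rw [lintegral_sqrt_mul_norm_ricianFading hK hu (Measurable.indicator (by fun_prop)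
    measurableSet_Ici), Measure.restrict_congr_set Ioi_ae_eq_Ici,
    Measure.restrict_congr_set Ioi_ae_eq_Ici, ← lintegral_indicator measurableSet_Ici,
    ← lintegral_indicator measurableSet_Ici]
  refine lintegral_congr fun t => ?_
  by_cases ht : b ≤ t
  · have ht0 : 0 ≤ t := hb.trans ht
    rw [Set.indicator_of_mem (Set.mem_Ici.2 ht0), Set.indicator_of_mem (Set.mem_Ici.2 ht),
      Set.indicator_of_mem (Set.mem_Ici.2 ht), ← ENNReal.ofReal_mul (by positivity), pow_succ t i]
    simp only [mul_assoc]
  · simp [Set.indicator, ht]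

end Rician

/-! ### Generalities on expectations and independence -/

lemma integrable_and_integral_eq_of_lintegral {α : Type*} [MeasurableSpace α] {μ : Measure α}
    {f : α → ℝ} (hf : AEStronglyMeasurable f μ) (hf0 : 0 ≤ᵐ[μ] f) {c : ℝ} (hc : 0 ≤ c)
    (h : ∫⁻ x, ENNReal.ofReal (f x) ∂μ = ENNReal.ofReal c) :
    Integrable f μ ∧ ∫ x, f x ∂μ = c := by
  refine ⟨⟨hf, ?_⟩, ?_⟩
  · rw [hasFiniteIntegral_iff_ofReal hf0, h]
    exact ENNReal.ofReal_lt_top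
  · rw [integral_eq_lintegral_of_nonneg_ae hf0 hf, h, ENNReal.toReal_ofReal hc]

lemma indepFun_pi_of_disjoint_range {Ω ι α β E : Type*} [MeasurableSpace Ω] [MeasurableSpace E]
    {P : Measure Ω} {X : ι → Ω → E} (hind : iIndepFun X P) (hX : ∀ i, Measurable (X i))
    {f : α → ι} {g : β → ι} (hfg : Disjoint (Set.range f) (Set.range g)) :
    IndepFun (fun ω a => X (f a) ω) (fun ω b => X (g b) ω) P := by
  have hdisj := indep_iSup_of_disjoint (fun i => (hX i).comap_le) hind.iIndep hfg
  rw [IndepFun_iff_Indep]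
  simpa only [MeasurableSpace.pi, MeasurableSpace.comap_iSup, MeasurableSpace.comap_comp,
    iSup_range, Function.comp_def] using hdisj

lemma sq_rpow_half {x : ℝ} (hx : 0 ≤ x) (j : ℕ) : (x ^ 2) ^ ((j : ℝ) / 2) = x ^ j := by
  rw [← Real.rpow_natCast_mul hx, ← Real.rpow_natCast]
  congr 1
  push_cast
  ring

lemma rpow_half_eq_sqrt_pow {x : ℝ} (hx : 0 ≤ x) (j : ℕ) : x ^ ((j : ℝ) / 2) = √x ^ j := by
  rw [← sq_rpow_half (Real.sqrt_nonneg x), Real.sq_sqrt hx]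

/-! ### Positivity of the system constants -/

namespace System

variable {N L K : ℕ} (S : System N L K)

lemma rice_nonneg : ∀ e, 0 ≤ S.rice e
  | .ur _ => S.riceUR_nonneg
  | .rd _ => S.riceRD_nonneg
  | .ud => S.riceUD_nonneg
  | .aerial l => S.riceI_nonneg l
  | .ground k => S.riceJ_nonneg k

lemma snrCas_pos : 0 < S.snrCas := by
  have := S.PU_pos
  have := S.lossUR_pos
  have := S.lossRD_pos
  have := S.refl_pos
  have := S.noise_pos
  unfold snrCas
  positivity

lemma snrDir_nonneg : 0 ≤ S.snrDir := by
  have := S.PU_pos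
  have := S.lossUD_pos
  have := S.noise_pos
  unfold snrDir
  positivity

lemma lamUD_pos : 0 < S.lamUD :=
  div_pos (by linarith [S.riceUD_nonneg]) S.lossUD_pos

end System

lemma laguerreFn_neg_nonneg {k x : ℝ} (hk : 0 ≤ k) (hx : 0 ≤ x) : 0 ≤ laguerreFn k (-x) := by
  rw [← exp_neg_mul_tsum_eq_laguerreFn hk x]
  refine mul_nonneg (Real.exp_pos _).le (tsum_nonneg fun n => ?_)
  have := ascPochhammer_eval_one_add_nonneg hk n
  positivity

lemma momRice_nonneg {K k : ℝ} (hK : 0 ≤ K) (hk : 0 ≤ k) : 0 ≤ System.momRice K k := by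
  have := laguerreFn_neg_nonneg hk hK
  have := Real.Gamma_pos_of_pos (show 0 < 1 + k by linarith)
  unfold System.momRice
  positivity

lemma riceLaplace_pos {K c s : ℝ} (hc : 0 ≤ c) (hs : 0 ≤ s) : 0 < System.riceLaplace K c s := by
  unfold System.riceLaplace
  positivity

/-! ### The Nuttall function as a truncated moment -/

lemma nuttallQ_integrand_nonneg {a t : ℝ} (ht : 0 ≤ t) (i : ℕ) :
    0 ≤ t ^ i * Real.exp (-(t ^ 2 + a ^ 2) / 2) * besselI 0 (a * t) := by
  have := besselI_zero_pos (a * t)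
  positivity

lemma lintegral_indicator_norm_pow_ricianFading_lt_top {K : ℝ} (hK : 0 ≤ K) (b : ℝ) {u : ℂ}
    (hu : ‖u‖ = 1) (i : ℕ) :
    ∫⁻ z, (Set.Ici b).indicator (fun t => ENNReal.ofReal (t ^ i)) (√(2 * (K + 1)) * ‖z‖)
      ∂ricianFading K u < ⊤ :=
  calc _ ≤ ∫⁻ z, ENNReal.ofReal (√(2 * (K + 1)) ^ i) *
        ENNReal.ofReal ((‖z‖ ^ 2) ^ ((i : ℝ) / 2)) ∂ricianFading K u := by
        refine lintegral_mono fun z => (Set.indicator_le_self _ _ _).trans_eq ?_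
        rw [mul_pow, ENNReal.ofReal_mul (by positivity), sq_rpow_half (norm_nonneg z)]
    _ < ⊤ := by
        rw [lintegral_const_mul _ (by fun_prop),
          lintegral_rpow_ricianFading hK (by positivity) hu]
        exact ENNReal.mul_lt_top ENNReal.ofReal_lt_top ENNReal.ofReal_lt_top

theorem lintegral_indicator_norm_pow_eq_nuttallQ {K b : ℝ} (hK : 0 ≤ K) (hb : 0 ≤ b) {u : ℂ}
    (hu : ‖u‖ = 1) (i : ℕ) :
    ∫⁻ z, (Set.Ici b).indicator (fun t => ENNReal.ofReal (t ^ i)) (√(2 * (K + 1)) * ‖z‖)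
      ∂ricianFading K u = ENNReal.ofReal (nuttallQ (i + 1) 0 √(2 * K) b) := by
  have hfin := lintegral_indicator_norm_pow_ricianFading_lt_top hK b hu i
  rw [lintegral_indicator_norm_pow_ricianFading hK hb hu i] at hfin ⊢
  have hnn : 0 ≤ᵐ[volume.restrict (Set.Ioi b)] fun t : ℝ =>
      t ^ (i + 1) * Real.exp (-(t ^ 2 + √(2 * K) ^ 2) / 2) * besselI 0 (√(2 * K) * t) :=
    (ae_restrict_iff' measurableSet_Ioi).2 <| .of_forall fun t ht =>
      nuttallQ_integrand_nonneg (hb.trans (le_of_lt ht)) _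
  have := continuous_besselI_zero
  rw [nuttallQ, ofReal_integral_eq_lintegral_ofReal
    ⟨Continuous.aestronglyMeasurable (by fun_prop), ?_⟩ hnn]
  rwa [hasFiniteIntegral_iff_ofReal hnn]

lemma nuttallQ_nonneg (i : ℕ) (a : ℝ) {b : ℝ} (hb : 0 ≤ b) : 0 ≤ nuttallQ i 0 a b :=
  setIntegral_nonneg measurableSet_Ioi fun _ ht =>
    nuttallQ_integrand_nonneg (hb.trans (le_of_lt ht)) _

lemma nuttallQ_one_pos {K b : ℝ} (hK : 0 ≤ K) (hb : 0 ≤ b) : 0 < nuttallQ 1 0 √(2 * K) b := by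
  have hQ := lintegral_indicator_norm_pow_eq_nuttallQ hK hb (u := 1) (by simp) 0
  rw [lintegral_indicator_norm_pow_ricianFading hK hb (by simp) 0, zero_add] at hQ
  have := continuous_besselI_zero
  rw [← ENNReal.ofReal_pos, ← hQ,
    setLIntegral_pos_iff (Continuous.measurable (by fun_prop)).ennreal_ofReal]
  have hsupp : Set.Ioi b ⊆ (Function.support fun t : ℝ => ENNReal.ofReal (t ^ 1 *
      Real.exp (-(t ^ 2 + √(2 * K) ^ 2) / 2) * besselI 0 (√(2 * K) * t))) ∩ Set.Ioi b := by
    refine fun t ht => ⟨?_, ht⟩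
    have : 0 < t := hb.trans_lt ht
    have := besselI_zero_pos (√(2 * K) * t)
    rw [Function.mem_support, ← pos_iff_ne_zero, ENNReal.ofReal_pos]
    positivity
  exact lt_of_lt_of_le (by simp) (measure_mono hsupp)

/-! ### Blockage of the direct link -/

namespace System

variable {N L K : ℕ} (S : System N L K)

lemma sqrt_le_iff_not_blocked (z : ℂ) :
    √(2 * S.lamUD * S.τ) ≤ √(2 * (S.riceUD + 1)) * ‖z‖ ↔ ¬ S.lossUD * ‖z‖ ^ 2 < S.τ := by
  have : 0 < S.riceUD + 1 := by linarith [S.riceUD_nonneg]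
  have := S.lossUD_pos
  rw [not_lt, Real.sqrt_le_left (by positivity), mul_pow, Real.sq_sqrt (by positivity), lamUD,
    show 2 * ((S.riceUD + 1) / S.lossUD) * S.τ = (2 * (S.riceUD + 1) / S.lossUD) * S.τ by ring,
    show 2 * (S.riceUD + 1) * ‖z‖ ^ 2 = (2 * (S.riceUD + 1) / S.lossUD) * (S.lossUD * ‖z‖ ^ 2) by
      field_simp]
  exact mul_le_mul_iff_right₀ (by positivity)

lemma measurableSet_blocked : MeasurableSet {z : ℂ | S.lossUD * ‖z‖ ^ 2 < S.τ} :=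
  measurableSet_lt (by fun_prop) (by fun_prop)

theorem blockProb_eq :
    S.blockProb = 1 - nuttallQ 1 0 √(2 * S.riceUD) √(2 * S.lamUD * S.τ) := by
  have hunblocked : ricianFading S.riceUD (S.los .ud) {z | S.lossUD * ‖z‖ ^ 2 < S.τ}ᶜ =
      ENNReal.ofReal (nuttallQ 1 0 √(2 * S.riceUD) √(2 * S.lamUD * S.τ)) := by
    refine Eq.trans ?_ (lintegral_indicator_norm_pow_eq_nuttallQ S.riceUD_nonneg
      (Real.sqrt_nonneg _) (S.norm_los .ud) 0)
    rw [← lintegral_indicator_one S.measurableSet_blocked.compl]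
    refine lintegral_congr fun z => ?_
    simp only [Set.indicator, Set.mem_compl_iff, Set.mem_ofPred_eq, Set.mem_Ici,
      S.sqrt_le_iff_not_blocked, pow_zero, ENNReal.ofReal_one, Pi.one_apply]
  have hcompl := probReal_compl_eq_one_sub (μ := ricianFading S.riceUD (S.los .ud))
    S.measurableSet_blocked
  rw [measureReal_def _ (_ᶜ), hunblocked,
    ENNReal.toReal_ofReal (nuttallQ_nonneg _ _ (Real.sqrt_nonneg _))] at hcompl
  rw [blockProb, hcompl, sub_sub_cancel]

lemma blockProb_lt_one : S.blockProb < 1 := by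
  rw [S.blockProb_eq]
  linarith [nuttallQ_one_pos S.riceUD_nonneg (Real.sqrt_nonneg (2 * S.lamUD * S.τ))]

lemma steady_one_div : S.steady 1 / (1 - S.blockProb) = 1 := by
  have hsteady : S.steady 1 = 1 - S.blockProb := by simp [steady, transition]
  rw [hsteady, div_self (sub_pos.2 S.blockProb_lt_one).ne']

/-- `γ = γ_dir γ̄_dir / γ̄_cas` as a function of the coefficient of the direct link. -/
noncomputable def dirGain (z : ℂ) : ℝ :=
  if S.lossUD * ‖z‖ ^ 2 < S.τ then 0 else ‖z‖ ^ 2 * S.snrDir / S.snrCas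

@[fun_prop]
lemma measurable_dirGain : Measurable S.dirGain :=
  Measurable.ite S.measurableSet_blocked measurable_const (by fun_prop)

lemma ofReal_dirGain_rpow {i : ℕ} (hi : i ≠ 0) (z : ℂ) :
    ENNReal.ofReal (S.dirGain z ^ ((i : ℝ) / 2)) =
      ENNReal.ofReal (((2 * S.lamUD * S.noise * S.snrCas / S.PU) ^ ((i : ℝ) / 2))⁻¹) *
        (Set.Ici √(2 * S.lamUD * S.τ)).indicator (fun t => ENNReal.ofReal (t ^ i))
          (√(2 * (S.riceUD + 1)) * ‖z‖) := by
  by_cases hz : S.lossUD * ‖z‖ ^ 2 < S.τ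
  · have hzero : ((i : ℝ) / 2) ≠ 0 := by positivity
    have hnotMem := mt (S.sqrt_le_iff_not_blocked z).1 (not_not.2 hz)
    rw [Set.indicator_of_notMem (Set.mem_Ici.not.2 hnotMem), dirGain, if_pos hz,
      Real.zero_rpow hzero, ENNReal.ofReal_zero, mul_zero]
  · have := S.snrCas_pos
    have := S.lossUD_pos
    have := S.PU_pos
    have := S.noise_pos
    have := S.lamUD_pos
    have : 0 < S.riceUD + 1 := by linarith [S.riceUD_nonneg]
    rw [Set.indicator_of_mem (Set.mem_Ici.2 ((S.sqrt_le_iff_not_blocked z).2 hz)), dirGain,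
      if_neg hz, ← ENNReal.ofReal_mul (by positivity),
      ← sq_rpow_half (show 0 ≤ √(2 * (S.riceUD + 1)) * ‖z‖ by positivity),
      ← Real.inv_rpow (by positivity), ← Real.mul_rpow (by positivity) (by positivity), mul_pow,
      Real.sq_sqrt (by positivity), snrDir, lamUD]
    congr 2
    field_simp

end System

namespace Channels

variable {N L K : ℕ} {S : System N L K} {Ω : Type*} [MeasurableSpace Ω] {P : Measure Ω}
  (C : Channels S P)

/-! ### The gains as random variables -/

lemma gCas_nonneg (ω : Ω) : 0 ≤ C.gCas ω := sq_nonneg _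

lemma gDir_nonneg (ω : Ω) : 0 ≤ C.gDir ω := by
  unfold gDir
  positivity

lemma gDirN_nonneg (ω : Ω) : 0 ≤ C.gDirN ω :=
  div_nonneg (mul_nonneg (C.gDir_nonneg ω) S.snrDir_nonneg) S.snrCas_pos.le

@[fun_prop]
lemma measurable_gCas : Measurable C.gCas := by
  have := C.measurable_h
  unfold gCas
  fun_prop

@[fun_prop]
lemma measurable_gDirN : Measurable C.gDirN := by
  have := C.measurable_h
  have : Measurable fun ω => ((C.state 0 ω : ℕ) : ℝ) :=
    (measurable_of_finite fun i : Fin 2 => ((i : ℕ) : ℝ)).comp (C.measurable_state 0)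
  unfold gDirN gDir
  fun_prop

@[fun_prop]
lemma measurable_gA2G : Measurable C.gA2G := by
  unfold gA2G
  simp only [sq_abs]
  fun_prop

@[fun_prop]
lemma measurable_inr : Measurable C.inr := by
  have := C.measurable_h
  unfold inr
  fun_prop

lemma gDirN_ae_eq : C.gDirN =ᵐ[P] fun ω => S.dirGain (C.h .ud ω) := by
  filter_upwards [C.blocked_iff] with ω hω
  rw [gDirN, gDir, System.dirGain]
  by_cases hstate : C.state 0 ω = 0
  · simp [hstate, hω.1 hstate]
  · have hone : C.state 0 ω = 1 := by omega
    simp [hone, mt hω.2 hstate]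

/-! ### Independence of the gains -/

/-- The links that carry the signal: the direct link and the two hops through each element of
the RIS, the first hop being tagged by `true`. -/
def signalLink : Option (Fin N × Bool) → Link N L K
  | none => .ud
  | some (n, true) => .ur n
  | some (n, false) => .rd n

/-- The link of an interferer. -/
def intLink : Fin L ⊕ Fin K → Link N L K := Sum.elim .aerial .ground

lemma signalLink_injective :
    Function.Injective (signalLink : Option (Fin N × Bool) → Link N L K) := by
  rintro (_ | ⟨_, _ | _⟩) (_ | ⟨_, _ | _⟩) <;> simp [signalLink]

lemma intLink_injective : Function.Injective (intLink : Fin L ⊕ Fin K → Link N L K) := by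
  rintro (_ | _) (_ | _) <;> simp [intLink]

lemma disjoint_range_signalLink_intLink :
    Disjoint (Set.range (signalLink : Option (Fin N × Bool) → Link N L K))
      (Set.range (intLink : Fin L ⊕ Fin K → Link N L K)) := by
  rw [Set.disjoint_range_iff]
  rintro (_ | ⟨_, _ | _⟩) (_ | _) <;> simp [signalLink, intLink]

lemma inr_eq (ω : Ω) : C.inr ω = ∑ x, S.inrInt x * ‖C.h (intLink x) ω‖ ^ 2 := by
  rw [Fintype.sum_sum_type]
  rfl

lemma iIndepFun_cascade : iIndepFun (fun n ω => ‖C.h (.ur n) ω‖ * ‖C.h (.rd n) ω‖) P := by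
  have hhops : iIndepFun (fun (n : Fin N) ω (hop : Bool) => C.h (signalLink (some (n, hop))) ω) P :=
    iIndepFun_curry (fun _ _ => C.measurable_h _) <|
      C.indep_h.precomp (g := fun p : (_ : Fin N) × Bool => signalLink (some (p.1, p.2)))
        (signalLink_injective.comp ((Option.some_injective _).comp fun _ _ => by aesop))
  exact hhops.comp (fun _ x => ‖x true‖ * ‖x false‖) fun _ => by fun_prop

lemma indepFun_gCas_gDirN : IndepFun C.gCas C.gDirN P := by
  refine IndepFun.congr ?_ (Filter.EventuallyEq.refl _ C.gCas) C.gDirN_ae_eq.symm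
  have hdisj : Disjoint (Set.range fun p : Fin N × Bool => (signalLink (some p) : Link N L K))
      (Set.range fun _ : Unit => Link.ud) := by
    rw [Set.disjoint_range_iff]
    rintro ⟨_, _ | _⟩ _ <;> simp [signalLink]
  exact (indepFun_pi_of_disjoint_range C.indep_h C.measurable_h hdisj).comp
    (show Measurable fun x => (∑ n, ‖x (n, true)‖ * ‖x (n, false)‖) ^ 2 by fun_prop)
    (show Measurable fun y => S.dirGain (y ()) by fun_prop)

lemma indepFun_gA2G_inr : IndepFun C.gA2G C.inr P := by
  have hgA2G : (fun ω => (√(C.gCas ω) + √(S.dirGain (C.h .ud ω))) ^ 2) =ᵐ[P] C.gA2G := by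
    filter_upwards [C.gDirN_ae_eq] with ω hω
    rw [gA2G, sq_abs, hω]
  refine IndepFun.congr (g := fun ω => ∑ x, S.inrInt x * ‖C.h (intLink x) ω‖ ^ 2) ?_ hgA2G
    (Filter.Eventually.of_forall fun ω => (C.inr_eq ω).symm)
  exact (indepFun_pi_of_disjoint_range C.indep_h C.measurable_h
    disjoint_range_signalLink_intLink).comp
    (show Measurable fun x => (√((∑ n, ‖x (some (n, true))‖ * ‖x (some (n, false))‖) ^ 2) +
      √(S.dirGain (x none))) ^ 2 by fun_prop)
    (show Measurable fun y => ∑ x, S.inrInt x * ‖y x‖ ^ 2 by fun_prop)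

/-! ### Moments of the gains -/

lemma lintegral_comp_h (e : Link N L K) {f : ℂ → ENNReal} (hf : Measurable f) :
    ∫⁻ ω, f (C.h e ω) ∂P = ∫⁻ z, f z ∂ricianFading (S.rice e) (S.los e) := by
  rw [← (C.law_h e).map_eq, lintegral_map hf (C.measurable_h e)]

theorem integral_norm_h_pow (e : Link N L K) (j : ℕ) :
    Integrable (fun ω => ‖C.h e ω‖ ^ j) P ∧
      ∫ ω, ‖C.h e ω‖ ^ j ∂P = System.momRice (S.rice e) ((j : ℝ) / 2) := by
  have := C.measurable_h e
  refine integrable_and_integral_eq_of_lintegral (Measurable.aestronglyMeasurable (by fun_prop))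
    (.of_forall fun ω => by positivity) (momRice_nonneg (S.rice_nonneg e) (by positivity)) ?_
  rw [C.lintegral_comp_h e (f := fun z => ENNReal.ofReal (‖z‖ ^ j)) (by fun_prop),
    ← lintegral_rpow_ricianFading (S.rice_nonneg e) (by positivity) (S.norm_los e)]
  simp_rw [sq_rpow_half (norm_nonneg _)]

lemma integral_cascade_pow (n : Fin N) (i : ℕ) :
    Integrable (fun ω => (‖C.h (.ur n) ω‖ * ‖C.h (.rd n) ω‖) ^ i) P ∧
      ∫ ω, (‖C.h (.ur n) ω‖ * ‖C.h (.rd n) ω‖) ^ i ∂P =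
        System.momRice S.riceUR ((i : ℝ) / 2) * System.momRice S.riceRD ((i : ℝ) / 2) := by
  obtain ⟨hur, hur_eq⟩ := C.integral_norm_h_pow (.ur n) i
  obtain ⟨hrd, hrd_eq⟩ := C.integral_norm_h_pow (.rd n) i
  have hind : IndepFun (fun ω => ‖C.h (.ur n) ω‖ ^ i) (fun ω => ‖C.h (.rd n) ω‖ ^ i) P :=
    (C.indep_h.indepFun (i := .ur n) (j := .rd n) (by simp)).comp
      (measurable_norm.pow_const i) (measurable_norm.pow_const i)
  simp_rw [mul_pow]
  refine ⟨hind.integrable_mul hur hrd, ?_⟩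
  rw [hind.integral_fun_mul_eq_mul_integral hur.aestronglyMeasurable hrd.aestronglyMeasurable,
    hur_eq, hrd_eq]
  rfl

theorem integral_gCas_rpow (j : ℕ) :
    Integrable (fun ω => C.gCas ω ^ ((j : ℝ) / 2)) P ∧
      ∫ ω, C.gCas ω ^ ((j : ℝ) / 2) ∂P = S.momCas j := by
  have := C.indep_h.isProbabilityMeasure
  have hpow : ∀ ω, C.gCas ω ^ ((j : ℝ) / 2) = (∑ n, ‖C.h (.ur n) ω‖ * ‖C.h (.rd n) ω‖) ^ j :=
    fun ω => sq_rpow_half (by positivity) j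
  have hint := fun n i => (C.integral_cascade_pow n i).1
  simp_rw [hpow]
  refine ⟨integrable_sum_pow hint Finset.univ j, ?_⟩
  rw [integral_sum_pow_eq_sum_partitionTerm C.iIndepFun_cascade hint
    (fun n i => (C.integral_cascade_pow n i).2), Finset.card_univ, Fintype.card_fin,
    System.momCas]

theorem integral_gDirN_rpow (i : ℕ) :
    Integrable (fun ω => C.gDirN ω ^ ((i : ℝ) / 2)) P ∧
      ∫ ω, C.gDirN ω ^ ((i : ℝ) / 2) ∂P = S.momDir i := by
  have := C.indep_h.isProbabilityMeasure
  rcases eq_or_ne i 0 with rfl | hi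
  · simp [System.momDir]
  have := S.snrCas_pos
  have := S.PU_pos
  have := S.noise_pos
  have := S.lamUD_pos
  have := nuttallQ_nonneg (i + 1) √(2 * S.riceUD) (Real.sqrt_nonneg (2 * S.lamUD * S.τ))
  have hmom : S.momDir i =
      ((2 * S.lamUD * S.noise * S.snrCas / S.PU) ^ ((i : ℝ) / 2))⁻¹ *
        nuttallQ (i + 1) 0 √(2 * S.riceUD) √(2 * S.lamUD * S.τ) := by
    rw [System.momDir, if_neg hi, S.steady_one_div, one_mul, div_eq_inv_mul (nuttallQ _ _ _ _)]
  rw [hmom]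
  refine integrable_and_integral_eq_of_lintegral (Measurable.aestronglyMeasurable (by fun_prop))
    (.of_forall fun ω => Real.rpow_nonneg (C.gDirN_nonneg ω) _) (by positivity) ?_
  calc ∫⁻ ω, ENNReal.ofReal (C.gDirN ω ^ ((i : ℝ) / 2)) ∂P
      = ∫⁻ ω, ENNReal.ofReal (S.dirGain (C.h .ud ω) ^ ((i : ℝ) / 2)) ∂P := by
        refine lintegral_congr_ae ?_
        filter_upwards [C.gDirN_ae_eq] with ω hω
        rw [hω]
    _ = ∫⁻ z, ENNReal.ofReal (S.dirGain z ^ ((i : ℝ) / 2)) ∂ricianFading S.riceUD (S.los .ud) :=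
        C.lintegral_comp_h .ud (f := fun z => ENNReal.ofReal (S.dirGain z ^ ((i : ℝ) / 2)))
          (by fun_prop)
    _ = _ := by
        simp_rw [S.ofReal_dirGain_rpow hi]
        rw [lintegral_const_mul' _ _ ENNReal.ofReal_ne_top,
          lintegral_indicator_norm_pow_eq_nuttallQ S.riceUD_nonneg (Real.sqrt_nonneg _)
            (S.norm_los .ud), ← ENNReal.ofReal_mul (by positivity)]

theorem integral_gA2G_pow (k : ℕ) :
    Integrable (fun ω => C.gA2G ω ^ k) P ∧ ∫ ω, C.gA2G ω ^ k ∂P = S.momA2G k := by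
  have := C.indep_h.isProbabilityMeasure
  have hexpand : ∀ ω, C.gA2G ω ^ k = ∑ i ∈ Finset.range (2 * k + 1), ((2 * k).choose i : ℝ) *
      (C.gCas ω ^ (((2 * k - i : ℕ) : ℝ) / 2) * C.gDirN ω ^ ((i : ℝ) / 2)) := fun ω => by
    rw [gA2G, sq_abs, ← pow_mul, add_comm, add_pow]
    refine Finset.sum_congr rfl fun i _ => ?_
    rw [rpow_half_eq_sqrt_pow (C.gCas_nonneg ω), rpow_half_eq_sqrt_pow (C.gDirN_nonneg ω)]
    ring
  have hind : ∀ a b : ℝ, IndepFun (fun ω => C.gCas ω ^ a) (fun ω => C.gDirN ω ^ b) P := fun a b =>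
    C.indepFun_gCas_gDirN.comp (measurable_id.pow_const a) (measurable_id.pow_const b)
  have hint : ∀ i ∈ Finset.range (2 * k + 1), Integrable (fun ω => ((2 * k).choose i : ℝ) *
      (C.gCas ω ^ (((2 * k - i : ℕ) : ℝ) / 2) * C.gDirN ω ^ ((i : ℝ) / 2))) P := fun i _ =>
    ((hind _ _).integrable_mul (C.integral_gCas_rpow _).1 (C.integral_gDirN_rpow i).1).const_mul _
  simp_rw [hexpand]
  refine ⟨integrable_finsetSum _ hint, ?_⟩
  rw [integral_finsetSum _ hint, System.momA2G]
  refine Finset.sum_congr rfl fun i _ => ?_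
  rw [integral_const_mul, (hind _ _).integral_fun_mul_eq_mul_integral
    (C.integral_gCas_rpow _).1.aestronglyMeasurable
    (C.integral_gDirN_rpow _).1.aestronglyMeasurable, (C.integral_gCas_rpow _).2,
    (C.integral_gDirN_rpow _).2, mul_assoc]

/-! ### Laplace transform of the interference and law of the SINR -/

lemma integral_exp_neg_sq_norm_h (x : Fin L ⊕ Fin K) {s : ℝ} (hs : 0 ≤ s) :
    ∫ ω, Real.exp (-s * (S.inrInt x * ‖C.h (intLink x) ω‖ ^ 2)) ∂P =
      System.riceLaplace (S.riceInt x) (S.inrInt x / (S.riceInt x + 1)) s := by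
  have hrice : S.rice (intLink x) = S.riceInt x := by cases x <;> rfl
  have := C.measurable_h (intLink x)
  have hscale : 0 ≤ S.inrInt x / (S.riceInt x + 1) :=
    div_nonneg (S.inrInt_nonneg x) (by linarith [S.riceInt_nonneg x])
  refine (integrable_and_integral_eq_of_lintegral
    (Measurable.aestronglyMeasurable (by fun_prop)) (.of_forall fun ω => (Real.exp_pos _).le)
    (riceLaplace_pos hscale hs).le ?_).2
  rw [C.lintegral_comp_h (intLink x)
    (f := fun z => ENNReal.ofReal (Real.exp (-s * (S.inrInt x * ‖z‖ ^ 2)))) (by fun_prop), hrice,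
    lintegral_exp_neg_sq_norm_ricianFading (S.riceInt_nonneg x) (S.inrInt_nonneg x) hs
      (S.norm_los _)]

theorem integral_exp_neg_inr {s : ℝ} (hs : 0 ≤ s) :
    ∫ ω, Real.exp (-s * (C.inr ω + 1)) ∂P = S.delta0 s := by
  have hprod : ∀ ω, Real.exp (-s * (C.inr ω + 1)) = Real.exp (-s) *
      ∏ x, Real.exp (-s * (S.inrInt x * ‖C.h (intLink x) ω‖ ^ 2)) := fun ω => by
    rw [← Real.exp_sum, ← Real.exp_add, C.inr_eq, ← Finset.mul_sum]
    ring_nf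
  simp_rw [hprod]
  rw [integral_const_mul, S.delta0_eq,
    iIndepFun.integral_fun_prod_comp (X := fun x ω => C.h (intLink x) ω)
      (f := fun x z => Real.exp (-s * (S.inrInt x * ‖z‖ ^ 2)))
      (C.indep_h.precomp intLink_injective) (fun x => (C.measurable_h _).aemeasurable)
      (fun x => Continuous.aestronglyMeasurable (by fun_prop))]
  simp_rw [C.integral_exp_neg_sq_norm_h _ hs]

lemma sinr_eq (ω : Ω) : C.sinr ω = S.snrCas * C.gA2G ω / (C.inr ω + 1) := by
  have hcas := S.snrCas_pos
  have hdir : S.snrDir * C.gDir ω = S.snrCas * C.gDirN ω := by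
    rw [gDirN]
    field_simp
  rw [sinr, gA2G, sq_abs, sq_abs, hdir, Real.sqrt_mul hcas.le, Real.sqrt_mul hcas.le, ← mul_add,
    mul_pow, Real.sq_sqrt hcas.le]

theorem measureReal_sinr_le (x : ℝ) :
    P.real {ω | C.sinr ω ≤ x} = C.sinrCDF (P.map C.gA2G) x := by
  have := C.indep_h.isProbabilityMeasure
  have hmeas : MeasurableSet {q : ℝ × ℝ | S.snrCas * q.1 / (q.2 + 1) ≤ x} :=
    measurableSet_le (by fun_prop) (by fun_prop)
  have : IsProbabilityMeasure (P.map C.gA2G) :=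
    Measure.isProbabilityMeasure_map (by fun_prop)
  have hlaw : P.map (fun ω => (C.gA2G ω, C.inr ω)) =
      ((P.map C.gA2G).prod P).map (Prod.map id C.inr) := by
    rw [C.indepFun_gA2G_inr.map_prod_eq_prod_map_map (by fun_prop) (by fun_prop),
      ← Measure.map_prod_map _ _ measurable_id C.measurable_inr, Measure.map_id]
  calc P.real {ω | C.sinr ω ≤ x}
      = (P.map fun ω => (C.gA2G ω, C.inr ω)).real
          {q : ℝ × ℝ | S.snrCas * q.1 / (q.2 + 1) ≤ x} := by
        rw [map_measureReal_apply (by fun_prop) hmeas]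
        simp_rw [sinr_eq]
        rfl
    _ = C.sinrCDF (P.map C.gA2G) x := by
        rw [hlaw, map_measureReal_apply (by fun_prop) hmeas]
        rfl

end Channels

/-! ### Uniqueness of the Laplace transform on the half-line -/

section Laplace

open BoundedContinuousFunction

/-- The function `y ↦ e^{-y}` on the half-line; the polynomials in it are the dense subalgebra to
which the Stone–Weierstrass theorem is applied. -/
noncomputable def expNegBCF : NNReal →ᵇ ℝ :=
  BoundedContinuousFunction.ofNormedAddCommGroup (fun y : NNReal => Real.exp (-(y : ℝ)))
    (by fun_prop) 1 fun y => by
      rw [Real.norm_of_nonneg (Real.exp_pos _).le, Real.exp_le_one_iff, neg_nonpos]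
      exact y.2

lemma expNegBCF_apply (y : NNReal) : expNegBCF y = Real.exp (-(y : ℝ)) := rfl

lemma aeval_expNegBCF_monomial_apply (n : ℕ) (a : ℝ) (y : NNReal) :
    (Polynomial.aeval expNegBCF (Polynomial.monomial n a) : NNReal →ᵇ ℝ) y =
      a * Real.exp (-(n : ℝ) * y) := by
  rw [Polynomial.aeval_monomial, BoundedContinuousFunction.mul_apply,
    BoundedContinuousFunction.pow_apply, expNegBCF_apply, ← Real.exp_nat_mul,
    BoundedContinuousFunction.algebraMap_apply, smul_eq_mul, mul_one, mul_neg, neg_mul]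

lemma integral_aeval_expNegBCF_congr {μ ν : Measure NNReal} [IsFiniteMeasure μ] [IsFiniteMeasure ν]
    (h : ∀ n : ℕ, ∫ y, Real.exp (-(n : ℝ) * y) ∂μ = ∫ y, Real.exp (-(n : ℝ) * y) ∂ν)
    (p : Polynomial ℝ) :
    ∫ y, (Polynomial.aeval expNegBCF p : NNReal →ᵇ ℝ) y ∂μ =
      ∫ y, (Polynomial.aeval expNegBCF p : NNReal →ᵇ ℝ) y ∂ν := by
  induction p using Polynomial.induction_on' with
  | add p q hp hq =>
    simp only [map_add, BoundedContinuousFunction.coe_add, Pi.add_apply]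
    rw [integral_add (BoundedContinuousFunction.integrable _ _)
      (BoundedContinuousFunction.integrable _ _), integral_add
      (BoundedContinuousFunction.integrable _ _) (BoundedContinuousFunction.integrable _ _), hp, hq]
  | monomial n a =>
    simp only [aeval_expNegBCF_monomial_apply, integral_const_mul, h n]

theorem ext_of_integral_exp_neg_natCast_nnreal {μ ν : Measure NNReal} [IsFiniteMeasure μ]
    [IsFiniteMeasure ν]
    (h : ∀ n : ℕ, ∫ y, Real.exp (-(n : ℝ) * y) ∂μ = ∫ y, Real.exp (-(n : ℝ) * y) ∂ν) : μ = ν := by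
  let A : StarSubalgebra ℝ (NNReal →ᵇ ℝ) :=
    { (Polynomial.aeval (R := ℝ) expNegBCF).range with
      star_mem' := fun {f} hf => by
        have hstar : star f = f := by ext y; simp
        rwa [hstar] }
  refine ext_of_forall_mem_subalgebra_integral_eq_of_pseudoEMetric_complete_countable (𝕜 := ℝ)
    (A := A) ?_ ?_
  · intro x y hxy
    refine ⟨expNegBCF, ⟨expNegBCF.toContinuousMapStarₐ ℝ, ⟨expNegBCF, ?_, rfl⟩, rfl⟩, ?_⟩
    · exact ⟨Polynomial.X, Polynomial.aeval_X _⟩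
    · simpa [expNegBCF_apply] using hxy
  · rintro g ⟨p, rfl⟩
    exact integral_aeval_expNegBCF_congr h p

lemma map_coe_map_toNNReal {μ : Measure ℝ} (hμ : ∀ᵐ y ∂μ, 0 ≤ y) :
    (μ.map Real.toNNReal).map ((↑) : NNReal → ℝ) = μ := by
  rw [Measure.map_map (by fun_prop) (by fun_prop)]
  conv_rhs => rw [← Measure.map_id (μ := μ)]
  refine Measure.map_congr ?_
  filter_upwards [hμ] with y hy using Real.coe_toNNReal y hy

lemma integral_exp_neg_map_toNNReal {μ : Measure ℝ} (hμ : ∀ᵐ y ∂μ, 0 ≤ y) (s : ℝ) :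
    ∫ y, Real.exp (-s * y) ∂μ.map Real.toNNReal = ∫ y, Real.exp (-s * y) ∂μ := by
  rw [integral_map (by fun_prop) (Continuous.aestronglyMeasurable (by fun_prop))]
  refine integral_congr_ae ?_
  filter_upwards [hμ] with y hy
  rw [Real.coe_toNNReal y hy]

theorem ext_of_integral_exp_neg_natCast {μ ν : Measure ℝ} [IsFiniteMeasure μ] [IsFiniteMeasure ν]
    (hμ : ∀ᵐ y ∂μ, 0 ≤ y) (hν : ∀ᵐ y ∂ν, 0 ≤ y)
    (h : ∀ n : ℕ, ∫ y, Real.exp (-(n : ℝ) * y) ∂μ = ∫ y, Real.exp (-(n : ℝ) * y) ∂ν) : μ = ν := by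
  have hmap : μ.map Real.toNNReal = ν.map Real.toNNReal :=
    ext_of_integral_exp_neg_natCast_nnreal fun n => by
      rw [integral_exp_neg_map_toNNReal hμ, integral_exp_neg_map_toNNReal hν, h n]
  rw [← map_coe_map_toNNReal hμ, ← map_coe_map_toNNReal hν, hmap]

end Laplace

/-! ### Shadowed Rician laws -/

lemma ae_gammaMeasure_pos (a r : ℝ) : ∀ᵐ y ∂gammaMeasure a r, 0 < y := by
  have hm : MeasurableSet {y : ℝ | ¬ 0 < y} := measurableSet_Ioi.compl
  rw [ae_iff, ← lintegral_indicator_one hm,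
    lintegral_gammaMeasure a r (measurable_one.indicator hm),
    setLIntegral_congr_fun (g := fun _ => 0) measurableSet_Ioi, lintegral_zero]
  intro y (hy : 0 < y)
  simp [hy]

lemma integral_exp_neg_gammaMeasure {a r s : ℝ} (ha : 0 < a) (hr : 0 < r) (hs : 0 ≤ s) :
    Integrable (fun x => Real.exp (-s * x)) (gammaMeasure a r) ∧
      ∫ x, Real.exp (-s * x) ∂gammaMeasure a r = (r / (r + s)) ^ a :=
  integrable_and_integral_eq_of_lintegral (Continuous.aestronglyMeasurable (by fun_prop))
    (.of_forall fun _ => (Real.exp_pos _).le) (by positivity)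
    (lintegral_exp_neg_mul_gammaMeasure ha hr hs)

section ShadowedRician

variable {ψ Om s2 : ℝ}

lemma isProbabilityMeasure_nakagami (hψ : 0 < ψ) (Om : ℝ) :
    IsProbabilityMeasure (nakagami ψ Om) :=
  have := isProbabilityMeasure_gammaMeasure hψ one_pos
  Measure.isProbabilityMeasure_map (by fun_prop)

lemma measurable_shadowedRician_map (u : ℂ) :
    Measurable fun q : ℂ × ℝ => ‖q.1 + (q.2 : ℂ) * u‖ ^ 2 := by fun_prop

lemma isProbabilityMeasure_shadowedRician (hψ : 0 < ψ) (Om s2 : ℝ) (u : ℂ) :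
    IsProbabilityMeasure (shadowedRician ψ Om s2 u) :=
  have := isProbabilityMeasure_nakagami hψ Om
  Measure.isProbabilityMeasure_map (measurable_shadowedRician_map u).aemeasurable

lemma isProbabilityMeasure_sisr (hψ : 0 < ψ) (I : ℕ) (Om s2 : ℝ) (u : Fin I → ℂ) :
    IsProbabilityMeasure (sisr I ψ Om s2 u) :=
  have := fun i => isProbabilityMeasure_shadowedRician hψ Om s2 (u i)
  Measure.isProbabilityMeasure_map (by fun_prop)

lemma ae_shadowedRician_nonneg (ψ Om s2 : ℝ) (u : ℂ) :
    ∀ᵐ y ∂shadowedRician ψ Om s2 u, 0 ≤ y := by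
  rw [shadowedRician, ae_map_iff (measurable_shadowedRician_map u).aemeasurable measurableSet_Ici]
  exact Filter.Eventually.of_forall fun q => sq_nonneg _

lemma ae_sisr_nonneg (hψ : 0 < ψ) (I : ℕ) (Om s2 : ℝ) (u : Fin I → ℂ) :
    ∀ᵐ y ∂sisr I ψ Om s2 u, 0 ≤ y := by
  have := fun i => isProbabilityMeasure_shadowedRician hψ Om s2 (u i)
  rw [sisr, ae_map_iff (by fun_prop) measurableSet_Ici]
  have hall : ∀ᵐ x ∂(Measure.pi fun i => shadowedRician ψ Om s2 (u i)), ∀ i, 0 ≤ x i :=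
    ae_all_iff.2 fun i => (Measure.quasiMeasurePreserving_eval
      (fun i => shadowedRician ψ Om s2 (u i)) i).ae (ae_shadowedRician_nonneg ψ Om s2 (u i))
  filter_upwards [hall] with x hx using Finset.sum_nonneg fun i _ => hx i

lemma lintegral_nakagami (ψ Om : ℝ) {f : ℝ → ENNReal} (hf : Measurable f) :
    ∫⁻ r, f r ∂nakagami ψ Om = ∫⁻ g, f √(Om * g / ψ) ∂gammaMeasure ψ 1 := by
  rw [nakagami, lintegral_map hf (by fun_prop)]

/-- Conditionally on the Nakagami amplitude the law is Rician; its Laplace transform is exponential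
in the Gamma variable. -/
theorem lintegral_exp_neg_shadowedRician {t : ℝ} (hψ : 0 < ψ) (hOm : 0 ≤ Om) (hs2 : 0 < s2)
    {u : ℂ} (hu : ‖u‖ = 1) (ht : 0 ≤ t) :
    ∫⁻ y, ENNReal.ofReal (Real.exp (-t * y)) ∂shadowedRician ψ Om s2 u =
      ENNReal.ofReal ((1 + s2 * t)⁻¹ * ((1 + s2 * t) / (1 + (s2 + Om / ψ) * t)) ^ ψ) := by
  have := isProbabilityMeasure_nakagami hψ Om
  have hrate : 0 ≤ Om / ψ * t / (1 + s2 * t) := by positivity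
  have hcond : ∀ᵐ g ∂gammaMeasure ψ 1,
      ENNReal.ofReal (System.riceLaplace (‖((√(Om * g / ψ) : ℝ) : ℂ) * u‖ ^ 2 / s2) s2 t) =
        ENNReal.ofReal (1 + s2 * t)⁻¹ *
          ENNReal.ofReal (Real.exp (-(Om / ψ * t / (1 + s2 * t)) * g)) := by
    filter_upwards [ae_gammaMeasure_pos ψ 1] with g hg
    rw [norm_sqrt_mul _ hu, Real.sq_sqrt (by positivity), ← ENNReal.ofReal_mul (by positivity),
      System.riceLaplace, div_eq_inv_mul]
    congr 3
    field_simp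
    ring
  rw [shadowedRician, lintegral_map (by fun_prop) (measurable_shadowedRician_map u),
    lintegral_prod_symm _ (by fun_prop)]
  simp only [lintegral_exp_neg_sq_norm_add_complexGaussian hs2 ht]
  rw [lintegral_nakagami ψ Om (by unfold System.riceLaplace; fun_prop), lintegral_congr_ae hcond,
    lintegral_const_mul _ (by fun_prop), lintegral_exp_neg_mul_gammaMeasure hψ one_pos hrate,
    ← ENNReal.ofReal_mul (by positivity)]
  congr 3
  field_simp
  ring

theorem integral_exp_neg_shadowedRician {t : ℝ} (hψ : 0 < ψ) (hOm : 0 ≤ Om) (hs2 : 0 < s2)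
    {u : ℂ} (hu : ‖u‖ = 1) (ht : 0 ≤ t) :
    ∫ y, Real.exp (-t * y) ∂shadowedRician ψ Om s2 u =
      (1 + s2 * t)⁻¹ * ((1 + s2 * t) / (1 + (s2 + Om / ψ) * t)) ^ ψ :=
  (integrable_and_integral_eq_of_lintegral (Continuous.aestronglyMeasurable (by fun_prop))
    (.of_forall fun _ => (Real.exp_pos _).le) (by positivity)
    (lintegral_exp_neg_shadowedRician hψ hOm hs2 hu ht)).2

theorem integral_exp_neg_sisr {I : ℕ} {t : ℝ} (hψ : 0 < ψ) (hOm : 0 ≤ Om) (hs2 : 0 < s2)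
    {u : Fin I → ℂ} (hu : ∀ i, ‖u i‖ = 1) (ht : 0 ≤ t) :
    ∫ y, Real.exp (-t * y) ∂sisr I ψ Om s2 u =
      ((1 + s2 * t)⁻¹) ^ I * ((1 + s2 * t) / (1 + (s2 + Om / ψ) * t)) ^ ((I : ℝ) * ψ) := by
  have := fun i => isProbabilityMeasure_shadowedRician hψ Om s2 (u i)
  have hratio : 0 ≤ (1 + s2 * t) / (1 + (s2 + Om / ψ) * t) := by positivity
  rw [sisr, integral_map (by fun_prop) (Continuous.aestronglyMeasurable (by fun_prop))]
  simp only [Finset.mul_sum, Real.exp_sum]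
  rw [integral_fintype_prod_eq_prod (fun (_ : Fin I) (y : ℝ) => Real.exp (-t * y))]
  simp only [fun i => integral_exp_neg_shadowedRician hψ hOm hs2 (hu i) ht]
  rw [Finset.prod_const, Finset.card_univ, Fintype.card_fin, mul_pow, mul_comm (I : ℝ),
    Real.rpow_mul_natCast hratio]

end ShadowedRician

/-! ### Binomial mixtures of Erlang laws -/

section ErlangMixture

variable {m M : ℕ} {ξ α : ℝ}

/-- The binomial weight of `k` in `M` trials with success probability `1 / (ξ + 1)`. -/
noncomputable def mixWeight (M : ℕ) (ξ : ℝ) (k : ℕ) : ℝ :=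
  (M.choose k : ℝ) * (1 / (ξ + 1) ^ k) * (ξ / (ξ + 1)) ^ (M - k)

lemma mixWeight_nonneg (hξ : 0 ≤ ξ) (M k : ℕ) : 0 ≤ mixWeight M ξ k := by
  unfold mixWeight
  positivity

lemma sum_mixWeight_mul_pow (M : ℕ) (ξ x : ℝ) :
    ∑ k ∈ Finset.range (M + 1), mixWeight M ξ k * x ^ k =
      (1 / (ξ + 1) * x + ξ / (ξ + 1)) ^ M := by
  rw [add_pow]
  refine Finset.sum_congr rfl fun k _ => ?_
  rw [mixWeight, mul_pow, one_div_pow]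
  ring

lemma sum_mixWeight (hξ : ξ + 1 ≠ 0) (M : ℕ) :
    ∑ k ∈ Finset.range (M + 1), mixWeight M ξ k = 1 := by
  have hsum := sum_mixWeight_mul_pow M ξ 1
  simp only [one_pow, mul_one] at hsum
  rw [hsum, ← add_div, add_comm, div_self hξ, one_pow]

/-- The mixture of the Erlang laws with shapes `m - k` and scale `α`, where `k` is binomial with
the weights `mixWeight M ξ k`. -/
noncomputable def erlangMixture (m M : ℕ) (ξ α : ℝ) : Measure ℝ :=
  ∑ k ∈ Finset.range (M + 1),
    ENNReal.ofReal (mixWeight M ξ k) • gammaMeasure ((m - k : ℕ) : ℝ) (1 / α)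

lemma natCast_sub_pos_of_mem_range (hM : M < m) {k : ℕ} (hk : k ∈ Finset.range (M + 1)) :
    (0 : ℝ) < ((m - k : ℕ) : ℝ) := by
  rw [Finset.mem_range] at hk
  exact Nat.cast_pos.2 (by omega)

lemma isProbabilityMeasure_erlang (hM : M < m) (hα : 0 < α) {k : ℕ}
    (hk : k ∈ Finset.range (M + 1)) :
    IsProbabilityMeasure (gammaMeasure ((m - k : ℕ) : ℝ) (1 / α)) :=
  isProbabilityMeasure_gammaMeasure (natCast_sub_pos_of_mem_range hM hk) (by positivity)

lemma isProbabilityMeasure_erlangMixture (hM : M < m) (hξ : 0 ≤ ξ) (hα : 0 < α) :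
    IsProbabilityMeasure (erlangMixture m M ξ α) := by
  refine ⟨?_⟩
  have hterm : ∀ k ∈ Finset.range (M + 1), (ENNReal.ofReal (mixWeight M ξ k) •
      gammaMeasure ((m - k : ℕ) : ℝ) (1 / α)) Set.univ = ENNReal.ofReal (mixWeight M ξ k) :=
    fun k hk => by
      have := isProbabilityMeasure_erlang hM hα hk
      rw [Measure.smul_apply, measure_univ, smul_eq_mul, mul_one]
  rw [erlangMixture, Measure.finsetSum_apply, Finset.sum_congr rfl hterm,
    ← ENNReal.ofReal_sum_of_nonneg fun k _ => mixWeight_nonneg hξ M k,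
    sum_mixWeight (by positivity), ENNReal.ofReal_one]

lemma ae_erlangMixture_nonneg (m M : ℕ) (ξ α : ℝ) : ∀ᵐ y ∂erlangMixture m M ξ α, 0 ≤ y := by
  rw [erlangMixture, ae_finsetSum_measure_iff]
  refine fun k _ => Measure.ae_smul_measure ?_ _
  filter_upwards [ae_gammaMeasure_pos ((m - k : ℕ) : ℝ) (1 / α)] with y hy using hy.le

lemma integral_erlangMixture (hξ : 0 ≤ ξ) {f : ℝ → ℝ}
    (hf : ∀ k ∈ Finset.range (M + 1), Integrable f (gammaMeasure ((m - k : ℕ) : ℝ) (1 / α))) :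
    Integrable f (erlangMixture m M ξ α) ∧ ∫ y, f y ∂erlangMixture m M ξ α =
      ∑ k ∈ Finset.range (M + 1), mixWeight M ξ k *
        ∫ y, f y ∂gammaMeasure ((m - k : ℕ) : ℝ) (1 / α) := by
  have hsmul : ∀ k ∈ Finset.range (M + 1), Integrable f
      (ENNReal.ofReal (mixWeight M ξ k) • gammaMeasure ((m - k : ℕ) : ℝ) (1 / α)) :=
    fun k hk => (hf k hk).smul_measure ENNReal.ofReal_ne_top
  refine ⟨integrable_finsetSum_measure.2 hsmul, ?_⟩
  rw [erlangMixture, integral_finsetSum_measure hsmul]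
  refine Finset.sum_congr rfl fun k _ => ?_
  rw [integral_smul_measure, ENNReal.toReal_ofReal (mixWeight_nonneg hξ M k), smul_eq_mul]

theorem integral_exp_neg_erlangMixture {s : ℝ} (hM : M < m) (hξ : 0 ≤ ξ) (hα : 0 < α)
    (hs : 0 ≤ s) :
    ∫ y, Real.exp (-s * y) ∂erlangMixture m M ξ α =
      ((1 + α * s)⁻¹) ^ m * (1 / (ξ + 1) * (1 + α * s) + ξ / (ξ + 1)) ^ M := by
  have hgamma := fun k (hk : k ∈ Finset.range (M + 1)) =>
    integral_exp_neg_gammaMeasure (natCast_sub_pos_of_mem_range hM hk) (one_div_pos.2 hα) hs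
  rw [(integral_erlangMixture hξ fun k hk => (hgamma k hk).1).2, ← sum_mixWeight_mul_pow,
    Finset.mul_sum]
  refine Finset.sum_congr rfl fun k hk => ?_
  have hkm : m - k + k = m := by
    rw [Finset.mem_range] at hk
    omega
  have hpow : ((1 + α * s)⁻¹) ^ m = ((1 + α * s)⁻¹) ^ (m - k) * ((1 + α * s)⁻¹) ^ k := by
    rw [← pow_add, hkm]
  rw [(hgamma k hk).2, Real.rpow_natCast, hpow,
    show 1 / α / (1 / α + s) = (1 + α * s)⁻¹ by field_simp, inv_pow _ k]
  field_simp

end ErlangMixture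

lemma le_of_natCast_eq_mul {I m : ℕ} {ψ : ℝ} (hψ : 1 ≤ ψ) (hm : (m : ℝ) = I * ψ) : I ≤ m := by
  have hle : (I : ℝ) ≤ m := hm ▸ le_mul_of_one_le_right I.cast_nonneg hψ
  exact_mod_cast hle

theorem sisr_eq_erlangMixture {I m : ℕ} {ψ Om s2 : ℝ} (hI : 1 ≤ I) (hψ : 1 ≤ ψ)
    (hm : (m : ℝ) = I * ψ) (hOm : 0 ≤ Om) (hs2 : 0 < s2) {u : Fin I → ℂ} (hu : ∀ i, ‖u i‖ = 1) :
    sisr I ψ Om s2 u = erlangMixture m (m - I) (Om / (s2 * ψ)) (s2 + Om / ψ) := by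
  have hψ0 : 0 < ψ := by linarith
  have hIm := le_of_natCast_eq_mul hψ hm
  have hM : m - I < m := by omega
  have hξ : 0 ≤ Om / (s2 * ψ) := by positivity
  have hα : 0 < s2 + Om / ψ := by positivity
  have := isProbabilityMeasure_sisr hψ0 I Om s2 u
  have := isProbabilityMeasure_erlangMixture hM hξ hα
  refine ext_of_integral_exp_neg_natCast (ae_sisr_nonneg hψ0 I Om s2 u)
    (ae_erlangMixture_nonneg _ _ _ _) fun n => ?_
  have hbase : 1 / (Om / (s2 * ψ) + 1) * (1 + (s2 + Om / ψ) * n) +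
      Om / (s2 * ψ) / (Om / (s2 * ψ) + 1) = 1 + s2 * n := by
    field_simp
    ring
  have hpow : (1 + s2 * (n : ℝ)) ^ m = (1 + s2 * n) ^ I * (1 + s2 * n) ^ (m - I) := by
    rw [← pow_add, Nat.add_sub_cancel' hIm]
  have : 0 < 1 + s2 * (n : ℝ) := by positivity
  rw [integral_exp_neg_sisr hψ0 hOm hs2 hu n.cast_nonneg,
    integral_exp_neg_erlangMixture hM hξ hα n.cast_nonneg, ← hm, Real.rpow_natCast, hbase, div_pow,
    hpow, inv_pow, inv_pow]
  field_simp

/-! ### Tails of Erlang laws -/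

lemma hasDerivAt_exp_neg (x : ℝ) : HasDerivAt (fun x => Real.exp (-x)) (-Real.exp (-x)) x := by
  simpa using (hasDerivAt_neg x).exp

lemma hasDerivAt_poissonWeight_succ (n : ℕ) (x : ℝ) :
    HasDerivAt (fun x => poissonWeight x (n + 1)) (poissonWeight x n - poissonWeight x (n + 1))
      x := by
  refine (((hasDerivAt_exp_neg x).mul (hasDerivAt_pow (n + 1) x)).div_const
    ((n + 1)! : ℝ)).congr_deriv ?_
  rw [poissonWeight, poissonWeight, Nat.factorial_succ, Nat.add_sub_cancel]
  push_cast
  field_simp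
  ring

lemma tendsto_poissonWeight_atTop (n : ℕ) :
    Filter.Tendsto (fun x => poissonWeight x n) Filter.atTop (nhds 0) := by
  have hlim := (Real.tendsto_pow_mul_exp_neg_atTop_nhds_zero n).div_const (n ! : ℝ)
  rw [zero_div] at hlim
  exact hlim.congr fun x => by rw [poissonWeight, mul_comm]

/-- The tail function `x ↦ P(Y > x)` of an Erlang variable `Y` of shape `k` and rate one, which is
the probability that a Poisson variable of mean `x` is less than `k`. -/
noncomputable def erlangTail (k : ℕ) (x : ℝ) : ℝ := ∑ n ∈ Finset.range k, poissonWeight x n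

lemma erlangTail_nonneg (k : ℕ) {x : ℝ} (hx : 0 ≤ x) : 0 ≤ erlangTail k x :=
  Finset.sum_nonneg fun n _ => poissonWeight_nonneg hx n

/-- The derivatives of the Poisson weights telescope. -/
lemma hasDerivAt_erlangTail_succ (k : ℕ) (x : ℝ) :
    HasDerivAt (erlangTail (k + 1)) (-poissonWeight x k) x := by
  induction k with
  | zero =>
    have htail : erlangTail (0 + 1) = fun x => Real.exp (-x) := by
      ext x
      simp [erlangTail, poissonWeight]
    simpa [htail, poissonWeight] using hasDerivAt_exp_neg x
  | succ k ih =>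
    have htail : erlangTail (k + 1 + 1) =
        fun x => erlangTail (k + 1) x + poissonWeight x (k + 1) :=
      funext fun x => Finset.sum_range_succ _ _
    rw [htail]
    exact (ih.add (hasDerivAt_poissonWeight_succ k x)).congr_deriv (by ring)

lemma tendsto_erlangTail_atTop (k : ℕ) :
    Filter.Tendsto (erlangTail k) Filter.atTop (nhds 0) := by
  have hlim := tendsto_finsetSum (Finset.range k) fun n _ => tendsto_poissonWeight_atTop n
  rwa [Finset.sum_const_zero] at hlim

lemma gamma_density_natCast_add_one (j : ℕ) (r x : ℝ) :
    r ^ ((j : ℝ) + 1) / Real.Gamma (j + 1) * x ^ ((j : ℝ) + 1 - 1) * Real.exp (-(r * x)) =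
      r * poissonWeight (r * x) j := by
  rw [← Nat.cast_succ, Real.rpow_natCast, Nat.cast_succ, Real.Gamma_nat_eq_factorial,
    add_sub_cancel_right, Real.rpow_natCast, poissonWeight, pow_succ, mul_pow]
  ring

lemma gammaMeasure_Ioi (a r : ℝ) {c : ℝ} (hc : 0 ≤ c) :
    gammaMeasure a r (Set.Ioi c) = ∫⁻ x in Set.Ioi c,
      ENNReal.ofReal (r ^ a / Real.Gamma a * x ^ (a - 1) * Real.exp (-(r * x))) := by
  rw [gammaMeasure, withDensity_apply _ measurableSet_Ioi]
  exact setLIntegral_congr_fun measurableSet_Ioi fun x hx =>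
    gammaPDF_of_nonneg (hc.trans (le_of_lt hx))

lemma gammaMeasure_real_Ioi (j : ℕ) {r c : ℝ} (hr : 0 < r) (hc : 0 ≤ c) :
    (gammaMeasure (j + 1) r).real (Set.Ioi c) = erlangTail (j + 1) (r * c) := by
  have hderiv : ∀ y ∈ Set.Ici c, HasDerivAt (fun y => erlangTail (j + 1) (r * y))
      (-(r * poissonWeight (r * y) j)) y := fun y _ =>
    ((hasDerivAt_erlangTail_succ j (r * y)).comp y ((hasDerivAt_id y).const_mul r)).congr_deriv
      (by ring)
  have hnonneg : ∀ y ∈ Set.Ioi c, 0 ≤ r * poissonWeight (r * y) j := fun y hy =>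
    mul_nonneg hr.le (poissonWeight_nonneg (mul_nonneg hr.le (hc.trans (le_of_lt hy))) j)
  have hnonpos : ∀ y ∈ Set.Ioi c, -(r * poissonWeight (r * y) j) ≤ 0 := fun y hy =>
    neg_nonpos.2 (hnonneg y hy)
  have hlim : Filter.Tendsto (fun y => erlangTail (j + 1) (r * y)) Filter.atTop (nhds 0) :=
    (tendsto_erlangTail_atTop (j + 1)).comp (Filter.tendsto_id.const_mul_atTop hr)
  have hint : IntegrableOn (fun y => r * poissonWeight (r * y) j) (Set.Ioi c) := by
    simpa only [neg_neg] using (integrableOn_Ioi_deriv_of_nonpos' hderiv hnonpos hlim).fun_neg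
  have hvalue : ∫ y in Set.Ioi c, r * poissonWeight (r * y) j = erlangTail (j + 1) (r * c) := by
    rw [← neg_inj, ← integral_neg, integral_Ioi_of_hasDerivAt_of_nonpos' hderiv hnonpos hlim,
      zero_sub]
  rw [measureReal_def, gammaMeasure_Ioi _ _ hc]
  simp_rw [gamma_density_natCast_add_one]
  rw [← ofReal_integral_eq_lintegral_ofReal hint
    ((ae_restrict_iff' measurableSet_Ioi).2 (.of_forall hnonneg)), hvalue,
    ENNReal.toReal_ofReal (erlangTail_nonneg _ (mul_nonneg hr.le hc))]

theorem gammaMeasure_real_Iic {k : ℕ} (hk : 0 < k) {r c : ℝ} (hr : 0 < r) (hc : 0 ≤ c) :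
    (gammaMeasure k r).real (Set.Iic c) = 1 - erlangTail k (r * c) := by
  obtain ⟨j, rfl⟩ := Nat.exists_eq_succ_of_ne_zero hk.ne'
  have := isProbabilityMeasure_gammaMeasure (Nat.cast_pos.2 hk) hr
  rw [← Set.compl_Ioi, probReal_compl_eq_one_sub measurableSet_Ioi, Nat.cast_succ,
    gammaMeasure_real_Ioi j hr hc]

section ErlangMixture

variable {m M : ℕ} {ξ α : ℝ}

theorem erlangMixture_real_Iic {c : ℝ} (hM : M < m) (hξ : 0 ≤ ξ) (hα : 0 < α) (hc : 0 ≤ c) :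
    (erlangMixture m M ξ α).real (Set.Iic c) =
      1 - ∑ k ∈ Finset.range (M + 1), mixWeight M ξ k * erlangTail (m - k) (c / α) := by
  have hind : ∀ k ∈ Finset.range (M + 1), Integrable ((Set.Iic c).indicator (1 : ℝ → ℝ))
      (gammaMeasure ((m - k : ℕ) : ℝ) (1 / α)) := fun k hk => by
    have := isProbabilityMeasure_erlang hM hα hk
    exact (integrable_const 1).indicator measurableSet_Iic
  calc (erlangMixture m M ξ α).real (Set.Iic c)
      = ∑ k ∈ Finset.range (M + 1), mixWeight M ξ k *
          (gammaMeasure ((m - k : ℕ) : ℝ) (1 / α)).real (Set.Iic c) := by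
        rw [← integral_indicator_one measurableSet_Iic, (integral_erlangMixture hξ hind).2]
        simp only [integral_indicator_one measurableSet_Iic]
    _ = ∑ k ∈ Finset.range (M + 1),
          (mixWeight M ξ k - mixWeight M ξ k * erlangTail (m - k) (c / α)) :=
        Finset.sum_congr rfl fun k hk => by
          rw [gammaMeasure_real_Iic (Nat.cast_pos.1 (natCast_sub_pos_of_mem_range hM hk))
            (by positivity) hc, one_div_mul_eq_div, mul_one_sub]
    _ = _ := by rw [Finset.sum_sub_distrib, sum_mixWeight (by positivity)]

/-! ### Moments of the Erlang mixture -/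

lemma eval_bernsteinPolynomial_eq_mixWeight (hξ : ξ + 1 ≠ 0) (k : ℕ) :
    (bernsteinPolynomial ℝ M k).eval (1 / (ξ + 1)) = mixWeight M ξ k := by
  rw [bernsteinPolynomial, mixWeight, ← one_div_pow]
  simp only [Polynomial.eval_mul, Polynomial.eval_natCast, Polynomial.eval_pow,
    Polynomial.eval_X, Polynomial.eval_sub, Polynomial.eval_one]
  rw [show 1 - 1 / (ξ + 1) = ξ / (ξ + 1) by field_simp; ring]

lemma sum_mul_mixWeight (hξ : ξ + 1 ≠ 0) (M : ℕ) :
    ∑ k ∈ Finset.range (M + 1), (k : ℝ) * mixWeight M ξ k = M * (1 / (ξ + 1)) := by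
  have hmean := congrArg (Polynomial.eval (1 / (ξ + 1))) (bernsteinPolynomial.sum_smul ℝ M)
  simpa only [Polynomial.eval_finsetSum, nsmul_eq_mul, Polynomial.eval_mul,
    Polynomial.eval_natCast, eval_bernsteinPolynomial_eq_mixWeight hξ, Polynomial.eval_X]
    using hmean

lemma sum_mul_sub_one_mul_mixWeight (hξ : ξ + 1 ≠ 0) (M : ℕ) :
    ∑ k ∈ Finset.range (M + 1), (k : ℝ) * (k - 1) * mixWeight M ξ k =
      M * (M - 1) * (1 / (ξ + 1)) ^ 2 := by
  have hcast : ∀ k : ℕ, ((k * (k - 1) : ℕ) : ℝ) = k * (k - 1) := fun k => by cases k <;> simp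
  have hmoment := congrArg (Polynomial.eval (1 / (ξ + 1))) (bernsteinPolynomial.sum_mul_smul ℝ M)
  simpa only [Polynomial.eval_finsetSum, nsmul_eq_mul, Polynomial.eval_mul,
    Polynomial.eval_natCast, eval_bernsteinPolynomial_eq_mixWeight hξ, Polynomial.eval_pow,
    Polynomial.eval_X, hcast] using hmoment

lemma integral_pow_gammaMeasure {a r : ℝ} (ha : 0 < a) (hr : 0 < r) (k : ℕ) :
    Integrable (fun x => x ^ k) (gammaMeasure a r) ∧
      ∫ x, x ^ k ∂gammaMeasure a r = (ascPochhammer ℝ k).eval a / r ^ k := by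
  have hpoch := ascPochhammer_pos k a ha
  refine integrable_and_integral_eq_of_lintegral (Continuous.aestronglyMeasurable (by fun_prop))
    ?_ (by positivity) ?_
  · filter_upwards [ae_gammaMeasure_pos a r] with x hx using pow_nonneg hx.le k
  · simpa only [Real.rpow_natCast, Gamma_add_natCast ha,
      mul_div_mul_left _ _ (Real.Gamma_pos_of_pos ha).ne'] using
      lintegral_rpow_gammaMeasure ha hr (Nat.cast_nonneg (α := ℝ) k)

theorem integral_id_erlangMixture (hM : M < m) (hξ : 0 ≤ ξ) (hα : 0 < α) :
    Integrable (fun y => y) (erlangMixture m M ξ α) ∧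
      ∫ y, y ∂erlangMixture m M ξ α = α * (m - M * (1 / (ξ + 1))) := by
  have hξ1 : ξ + 1 ≠ 0 := by positivity
  have hgamma : ∀ k ∈ Finset.range (M + 1),
      Integrable (fun y => y) (gammaMeasure ((m - k : ℕ) : ℝ) (1 / α)) ∧
        ∫ y, y ∂gammaMeasure ((m - k : ℕ) : ℝ) (1 / α) = α * (m - k) := fun k hk => by
    have hkm : k ≤ m := by rw [Finset.mem_range] at hk; omega
    simpa [Nat.cast_sub hkm, mul_comm] using integral_pow_gammaMeasure
      (natCast_sub_pos_of_mem_range hM hk) (one_div_pos.2 hα) 1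
  obtain ⟨hint, hvalue⟩ := integral_erlangMixture hξ fun k hk => (hgamma k hk).1
  refine ⟨hint, hvalue.trans ?_⟩
  calc ∑ k ∈ Finset.range (M + 1), mixWeight M ξ k * ∫ y, y ∂gammaMeasure ((m - k : ℕ) : ℝ) (1 / α)
      = ∑ k ∈ Finset.range (M + 1), α * (m * mixWeight M ξ k - k * mixWeight M ξ k) :=
        Finset.sum_congr rfl fun k hk => by rw [(hgamma k hk).2]; ring
    _ = α * (m - M * (1 / (ξ + 1))) := by
        rw [← Finset.mul_sum, Finset.sum_sub_distrib, ← Finset.mul_sum, sum_mixWeight hξ1,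
          sum_mul_mixWeight hξ1, mul_one]

theorem integral_sq_erlangMixture (hM : M < m) (hξ : 0 ≤ ξ) (hα : 0 < α) :
    Integrable (fun y => y ^ 2) (erlangMixture m M ξ α) ∧
      ∫ y, y ^ 2 ∂erlangMixture m M ξ α = α ^ 2 * (m * (m + 1) - 2 * m * (M * (1 / (ξ + 1))) +
        M * (M - 1) * (1 / (ξ + 1)) ^ 2) := by
  have hξ1 : ξ + 1 ≠ 0 := by positivity
  have hgamma : ∀ k ∈ Finset.range (M + 1),
      Integrable (fun y => y ^ 2) (gammaMeasure ((m - k : ℕ) : ℝ) (1 / α)) ∧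
        ∫ y, y ^ 2 ∂gammaMeasure ((m - k : ℕ) : ℝ) (1 / α) = α ^ 2 * ((m - k) * (m - k + 1)) :=
    fun k hk => by
      have hkm : k ≤ m := by rw [Finset.mem_range] at hk; omega
      simpa [Nat.cast_sub hkm, ascPochhammer_succ_eval, mul_comm] using integral_pow_gammaMeasure
        (natCast_sub_pos_of_mem_range hM hk) (one_div_pos.2 hα) 2
  obtain ⟨hint, hvalue⟩ := integral_erlangMixture hξ fun k hk => (hgamma k hk).1
  refine ⟨hint, hvalue.trans ?_⟩
  calc ∑ k ∈ Finset.range (M + 1),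
        mixWeight M ξ k * ∫ y, y ^ 2 ∂gammaMeasure ((m - k : ℕ) : ℝ) (1 / α)
      = ∑ k ∈ Finset.range (M + 1), α ^ 2 * (m * (m + 1) * mixWeight M ξ k -
          2 * m * (k * mixWeight M ξ k) + k * (k - 1) * mixWeight M ξ k) :=
        Finset.sum_congr rfl fun k hk => by rw [(hgamma k hk).2]; ring
    _ = _ := by
        rw [← Finset.mul_sum, Finset.sum_add_distrib, Finset.sum_sub_distrib, ← Finset.mul_sum,
          ← Finset.mul_sum, sum_mixWeight hξ1, sum_mul_mixWeight hξ1,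
          sum_mul_sub_one_mul_mixWeight hξ1, mul_one]

end ErlangMixture

namespace Channels

variable {N L K : ℕ} {S : System N L K} {Ω : Type*} [MeasurableSpace Ω] {P : Measure Ω}
  (C : Channels S P)

/-! ### Exponentially tilted moments of the interference -/

lemma inr_nonneg (ω : Ω) : 0 ≤ C.inr ω := by
  rw [C.inr_eq]
  exact Finset.sum_nonneg fun x _ => mul_nonneg (S.inrInt_nonneg x) (sq_nonneg _)

lemma Iic_zero_subset_integrableExpSet_inr :
    Set.Iic 0 ⊆ integrableExpSet (fun ω => C.inr ω + 1) P := by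
  intro t ht
  have := C.indep_h.isProbabilityMeasure
  have := C.measurable_inr
  refine Integrable.mono' (integrable_const (1 : ℝ))
    (Measurable.aestronglyMeasurable (by fun_prop)) (.of_forall fun ω => ?_)
  rw [Real.norm_of_nonneg (Real.exp_pos _).le, Real.exp_le_one_iff]
  exact mul_nonpos_of_nonpos_of_nonneg ht (by linarith [C.inr_nonneg ω])

/-- Differentiate `E[exp (-s W)] = Δ_D^(0)(s)` under the expectation. -/
theorem integral_pow_mul_exp_neg_inr {s : ℝ} (hs : 0 < s) (n : ℕ) :
    Integrable (fun ω => (C.inr ω + 1) ^ n * Real.exp (-s * (C.inr ω + 1))) P ∧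
      ∫ ω, (C.inr ω + 1) ^ n * Real.exp (-s * (C.inr ω + 1)) ∂P = (-1) ^ n * S.delta n s := by
  have hint : -s ∈ interior (integrableExpSet (fun ω => C.inr ω + 1) P) := by
    refine interior_mono C.Iic_zero_subset_integrableExpSet_inr ?_
    rw [interior_Iic]
    exact neg_neg_of_pos hs
  have hmgf : mgf (fun ω => C.inr ω + 1) P =ᶠ[nhds (-s)] fun t => S.delta0 (-t) := by
    filter_upwards [Iio_mem_nhds (neg_neg_of_pos hs)] with t ht
    rw [← C.integral_exp_neg_inr (neg_nonneg.2 (le_of_lt ht)), neg_neg]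
    rfl
  refine ⟨integrable_pow_mul_exp_of_mem_interior_integrableExpSet hint n, ?_⟩
  rw [← iteratedDeriv_mgf hint n, hmgf.iteratedDeriv_eq, iteratedDeriv_comp_neg, neg_neg,
    S.iteratedDeriv_delta0 n hs.le, smul_eq_mul]

/-! ### The SINR distribution for an Erlang mixture -/

lemma sinrCDF_eq_integral (ν : Measure ℝ) [IsFiniteMeasure ν] (x : ℝ) :
    C.sinrCDF ν x = ∫ ω, ν.real (Set.Iic (x / S.snrCas * (C.inr ω + 1))) ∂P := by
  have := C.indep_h.isProbabilityMeasure
  have hcas := S.snrCas_pos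
  have := C.measurable_inr
  have hmeas : MeasurableSet {q : ℝ × Ω | S.snrCas * q.1 / (C.inr q.2 + 1) ≤ x} :=
    measurableSet_le (by fun_prop) (by fun_prop)
  have hsection : ∀ ω, (fun y => (y, ω)) ⁻¹' {q : ℝ × Ω | S.snrCas * q.1 / (C.inr q.2 + 1) ≤ x} =
      Set.Iic (x / S.snrCas * (C.inr ω + 1)) := fun ω => by
    have hW : 0 < C.inr ω + 1 := by linarith [C.inr_nonneg ω]
    ext y
    rw [Set.mem_preimage, Set.mem_ofPred_eq, Set.mem_Iic, div_le_iff₀ hW, div_mul_eq_mul_div,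
      le_div_iff₀' hcas]
  rw [sinrCDF, measureReal_def, Measure.prod_apply_symm hmeas, ← integral_toReal
    (measurable_measure_prodMk_right hmeas).aemeasurable (.of_forall fun ω => measure_lt_top _ _)]
  simp only [hsection, measureReal_def]

lemma integral_erlangTail_inr (k : ℕ) {s : ℝ} (hs : 0 < s) :
    Integrable (fun ω => erlangTail k (s * (C.inr ω + 1))) P ∧
      ∫ ω, erlangTail k (s * (C.inr ω + 1)) ∂P =
        ∑ n ∈ Finset.range k, (-s) ^ n * S.delta n s / (n ! : ℝ) := by
  have htail : ∀ ω, erlangTail k (s * (C.inr ω + 1)) = ∑ n ∈ Finset.range k,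
      s ^ n / (n ! : ℝ) * ((C.inr ω + 1) ^ n * Real.exp (-s * (C.inr ω + 1))) := fun ω => by
    refine Finset.sum_congr rfl fun n _ => ?_
    rw [poissonWeight, mul_pow, neg_mul]
    ring
  have hint := fun n (_ : n ∈ Finset.range k) =>
    (C.integral_pow_mul_exp_neg_inr hs n).1.const_mul (s ^ n / (n ! : ℝ))
  simp_rw [htail]
  refine ⟨integrable_finsetSum _ hint, ?_⟩
  rw [integral_finsetSum _ hint]
  refine Finset.sum_congr rfl fun n _ => ?_
  rw [integral_const_mul, (C.integral_pow_mul_exp_neg_inr hs n).2, neg_pow s]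
  ring

theorem sinrCDF_erlangMixture {m M : ℕ} {ξ α x : ℝ} (hM : M < m) (hξ : 0 ≤ ξ) (hα : 0 < α)
    (hx : 0 < x) :
    C.sinrCDF (erlangMixture m M ξ α) x = 1 - ∑ k ∈ Finset.range (M + 1), mixWeight M ξ k *
      ∑ n ∈ Finset.range (m - k), (-(x / (α * S.snrCas))) ^ n *
        S.delta n (x / (α * S.snrCas)) / (n ! : ℝ) := by
  have := C.indep_h.isProbabilityMeasure
  have := isProbabilityMeasure_erlangMixture hM hξ hα
  have hcas := S.snrCas_pos
  have htail := fun k => C.integral_erlangTail_inr k (show 0 < x / (α * S.snrCas) by positivity)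
  have hint := fun k (_ : k ∈ Finset.range (M + 1)) =>
    (htail (m - k)).1.const_mul (mixWeight M ξ k)
  calc C.sinrCDF (erlangMixture m M ξ α) x
      = ∫ ω, (1 - ∑ k ∈ Finset.range (M + 1), mixWeight M ξ k *
          erlangTail (m - k) (x / (α * S.snrCas) * (C.inr ω + 1))) ∂P := by
        rw [C.sinrCDF_eq_integral]
        refine integral_congr_ae (.of_forall fun ω => ?_)
        have := C.inr_nonneg ω
        beta_reduce
        rw [erlangMixture_real_Iic hM hξ hα (by positivity),
          show x / S.snrCas * (C.inr ω + 1) / α = x / (α * S.snrCas) * (C.inr ω + 1) by field_simp]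
    _ = 1 - ∑ k ∈ Finset.range (M + 1), mixWeight M ξ k *
          ∫ ω, erlangTail (m - k) (x / (α * S.snrCas) * (C.inr ω + 1)) ∂P := by
        rw [integral_sub (integrable_const _) (integrable_finsetSum _ hint),
          integral_finsetSum _ hint, integral_const, probReal_univ, one_smul]
        simp only [integral_const_mul]
    _ = _ := by simp only [(htail _).2]

end Channels

/-! ### The SISR law -/

section SISR

variable {I m : ℕ} {ψ Om s2 : ℝ} {u : Fin I → ℂ}

theorem integral_id_sisr (hI : 1 ≤ I) (hψ : 1 ≤ ψ) (hm : (m : ℝ) = I * ψ) (hOm : 0 ≤ Om)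
    (hs2 : 0 < s2) (hu : ∀ i, ‖u i‖ = 1) :
    Integrable (fun y => y) (sisr I ψ Om s2 u) ∧ ∫ y, y ∂sisr I ψ Om s2 u = I * (s2 + Om) := by
  have : 0 < ψ := by linarith
  have hIm := le_of_natCast_eq_mul hψ hm
  obtain ⟨hint, hvalue⟩ := integral_id_erlangMixture (m := m) (M := m - I) (ξ := Om / (s2 * ψ))
    (α := s2 + Om / ψ) (by omega) (by positivity) (by positivity)
  rw [sisr_eq_erlangMixture hI hψ hm hOm hs2 hu]
  refine ⟨hint, ?_⟩
  rw [hvalue, Nat.cast_sub hIm, hm]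
  field_simp
  ring

theorem integral_sq_sisr (hI : 1 ≤ I) (hψ : 1 ≤ ψ) (hm : (m : ℝ) = I * ψ) (hOm : 0 ≤ Om)
    (hs2 : 0 < s2) (hu : ∀ i, ‖u i‖ = 1) :
    Integrable (fun y => y ^ 2) (sisr I ψ Om s2 u) ∧ ∫ y, y ^ 2 ∂sisr I ψ Om s2 u =
      (I * (s2 + Om)) ^ 2 + I * (s2 + Om) ^ 2 - I * Om ^ 2 * (ψ - 1) / ψ := by
  have : 0 < ψ := by linarith
  have hIm := le_of_natCast_eq_mul hψ hm
  have hα : 0 < s2 + Om / ψ := by positivity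
  have hprob : 1 / (Om / (s2 * ψ) + 1) = s2 / (s2 + Om / ψ) := by
    field_simp
    ring
  obtain ⟨hint, hvalue⟩ := integral_sq_erlangMixture (m := m) (M := m - I) (ξ := Om / (s2 * ψ))
    (α := s2 + Om / ψ) (by omega) (by positivity) hα
  rw [sisr_eq_erlangMixture hI hψ hm hOm hs2 hu]
  refine ⟨hint, ?_⟩
  rw [hvalue, hprob, Nat.cast_sub hIm, hm]
  field_simp
  ring

end SISR

/-! ### Moment matching -/

section MomentMatching

variable {I m : ℕ} {ψ μ₁ μ₂ : ℝ}

lemma sisrOmega_nonneg (I : ℕ) (ψ μ₁ μ₂ : ℝ) : 0 ≤ sisrOmega I ψ μ₁ μ₂ := by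
  unfold sisrOmega
  positivity

lemma sisrXi_eq (hs : sisrSigma2 I ψ μ₁ μ₂ ≠ 0) :
    sisrXi I ψ μ₁ μ₂ = sisrOmega I ψ μ₁ μ₂ / (sisrSigma2 I ψ μ₁ μ₂ * ψ) := by
  rw [sisrXi, sisrKappa, ← div_div]
  congr 1
  field_simp
  ring

lemma sisrAlpha_eq (hs : sisrSigma2 I ψ μ₁ μ₂ ≠ 0) :
    sisrAlpha I ψ μ₁ μ₂ = sisrSigma2 I ψ μ₁ μ₂ + sisrOmega I ψ μ₁ μ₂ / ψ := by
  rw [sisrAlpha, sisrXi_eq hs, sisrKappa]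
  field_simp
  ring

lemma natCast_mul_sisrSigma2_add_sisrOmega (hI : I ≠ 0) :
    (I : ℝ) * (sisrSigma2 I ψ μ₁ μ₂ + sisrOmega I ψ μ₁ μ₂) = μ₁ := by
  rw [sisrSigma2]
  field_simp
  ring

lemma natCast_mul_le_of_le_div (hI : 1 ≤ I) (h : (I : ℝ) ≤ μ₁ ^ 2 / (μ₂ - μ₁ ^ 2)) :
    I * μ₂ ≤ μ₁ ^ 2 * (I + 1) := by
  have hvar : 0 < μ₂ - μ₁ ^ 2 := by
    by_contra! hvar
    have := div_nonpos_of_nonneg_of_nonpos (sq_nonneg μ₁) hvar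
    have : (1 : ℝ) ≤ I := by exact_mod_cast hI
    linarith
  rw [le_div_iff₀ hvar] at h
  linarith

lemma sq_sisrOmega (hI : I ≠ 0) (hψ : 1 < ψ) (hμ : I * μ₂ ≤ μ₁ ^ 2 * (I + 1)) :
    (I : ℝ) ^ 2 * sisrOmega I ψ μ₁ μ₂ ^ 2 * (ψ - 1) = ψ * (μ₁ ^ 2 * (I + 1) - I * μ₂) := by
  have hψ1 : 0 < ψ - 1 := by linarith
  rw [sisrOmega, mul_pow, div_pow, div_pow, Real.sq_sqrt (by linarith), Real.sq_sqrt hψ1.le,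
    Real.sq_sqrt (by linarith)]
  field_simp

theorem integral_id_sisr_matched (hI : 1 ≤ I) (hψ : 1 ≤ ψ) (hm : (m : ℝ) = I * ψ)
    (hs : 0 < sisrSigma2 I ψ μ₁ μ₂) {u : Fin I → ℂ} (hu : ∀ i, ‖u i‖ = 1) :
    Integrable (fun y => y) (sisr I ψ (sisrOmega I ψ μ₁ μ₂) (sisrSigma2 I ψ μ₁ μ₂) u) ∧
      ∫ y, y ∂sisr I ψ (sisrOmega I ψ μ₁ μ₂) (sisrSigma2 I ψ μ₁ μ₂) u = μ₁ := by
  have hsisr := integral_id_sisr hI hψ hm (sisrOmega_nonneg I ψ μ₁ μ₂) hs hu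
  rwa [natCast_mul_sisrSigma2_add_sisrOmega (by omega)] at hsisr

theorem integral_sq_sisr_matched (hI : 1 ≤ I) (hψ : 1 < ψ) (hm : (m : ℝ) = I * ψ)
    (hs : 0 < sisrSigma2 I ψ μ₁ μ₂) (hμ : (I : ℝ) ≤ μ₁ ^ 2 / (μ₂ - μ₁ ^ 2)) {u : Fin I → ℂ}
    (hu : ∀ i, ‖u i‖ = 1) :
    Integrable (fun y => y ^ 2) (sisr I ψ (sisrOmega I ψ μ₁ μ₂) (sisrSigma2 I ψ μ₁ μ₂) u) ∧
      ∫ y, y ^ 2 ∂sisr I ψ (sisrOmega I ψ μ₁ μ₂) (sisrSigma2 I ψ μ₁ μ₂) u = μ₂ := by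
  have hI0 : I ≠ 0 := by omega
  have hmean := natCast_mul_sisrSigma2_add_sisrOmega (ψ := ψ) (μ₁ := μ₁) (μ₂ := μ₂) hI0
  have hOm := sq_sisrOmega hI0 hψ (natCast_mul_le_of_le_div hI hμ)
  obtain ⟨hint, hvalue⟩ := integral_sq_sisr hI hψ.le hm (sisrOmega_nonneg I ψ μ₁ μ₂) hs hu
  refine ⟨hint, hvalue.trans ?_⟩
  have hsq : (I : ℝ) * (sisrSigma2 I ψ μ₁ μ₂ + sisrOmega I ψ μ₁ μ₂) ^ 2 = μ₁ ^ 2 / I := by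
    rw [eq_div_iff (by positivity)]
    linear_combination
      (I * (sisrSigma2 I ψ μ₁ μ₂ + sisrOmega I ψ μ₁ μ₂) + μ₁) * hmean
  have hspread : (I : ℝ) * sisrOmega I ψ μ₁ μ₂ ^ 2 * (ψ - 1) / ψ =
      (μ₁ ^ 2 * (I + 1) - I * μ₂) / I := by
    rw [div_eq_div_iff (by linarith) (by positivity)]
    linear_combination hOm
  rw [hmean, hsq, hspread]
  field_simp
  ring

end MomentMatching

theorem Channels.sinrCDF_sisr {N L K : ℕ} {S : System N L K} {Ω : Type*} [MeasurableSpace Ω]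
    {P : Measure Ω} (C : Channels S P) {I m : ℕ} {ψ μ₁ μ₂ x : ℝ} (hI : 1 ≤ I) (hψ : 1 ≤ ψ)
    (hm : (m : ℝ) = I * ψ) (hs : 0 < sisrSigma2 I ψ μ₁ μ₂) {u : Fin I → ℂ}
    (hu : ∀ i, ‖u i‖ = 1) (hx : 0 < x) :
    C.sinrCDF (sisr I ψ (sisrOmega I ψ μ₁ μ₂) (sisrSigma2 I ψ μ₁ μ₂) u) x =
      1 - ∑ k ∈ Finset.range (m - I + 1), sisrChi I m ψ μ₁ μ₂ k *
        ∑ n ∈ Finset.range (m - k), (-(x / (sisrAlpha I ψ μ₁ μ₂ * S.snrCas))) ^ n *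
          S.delta n (x / (sisrAlpha I ψ μ₁ μ₂ * S.snrCas)) / (n ! : ℝ) := by
  have : 0 < ψ := by linarith
  have hIm := le_of_natCast_eq_mul hψ hm
  have hOm := sisrOmega_nonneg I ψ μ₁ μ₂
  have hξ : 0 ≤ sisrXi I ψ μ₁ μ₂ := by
    rw [sisrXi_eq hs.ne']
    positivity
  have hα : 0 < sisrAlpha I ψ μ₁ μ₂ := by
    rw [sisrAlpha_eq hs.ne']
    positivity
  rw [sisr_eq_erlangMixture hI hψ hm hOm hs hu, ← sisrXi_eq hs.ne', ← sisrAlpha_eq hs.ne']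
  exact C.sinrCDF_erlangMixture (by omega) hξ hα hx

end A2G

theorem theorem2 {Ω : Type*} [MeasurableSpace Ω] (P : Measure Ω) [IsProbabilityMeasure P]
    {N L K : ℕ} (S : A2G.System N L K) (C : A2G.Channels S P) :
    -- moments of the cascaded, direct and combined gains
    (∀ j : ℕ, Integrable (fun ω => C.gCas ω ^ ((j : ℝ) / 2)) P ∧
      ∫ ω, C.gCas ω ^ ((j : ℝ) / 2) ∂P = S.momCas j) ∧
    (∀ i : ℕ, Integrable (fun ω => C.gDirN ω ^ ((i : ℝ) / 2)) P ∧
      ∫ ω, C.gDirN ω ^ ((i : ℝ) / 2) ∂P = S.momDir i) ∧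
    S.blockProb = 1 - A2G.nuttallQ 1 0 √(2 * S.riceUD) √(2 * S.lamUD * S.τ) ∧
    (∀ k : ℕ, Integrable (fun ω => C.gA2G ω ^ k) P ∧ ∫ ω, C.gA2G ω ^ k ∂P = S.momA2G k) ∧
    -- the interference: Laplace transform and its derivatives
    (∀ s : ℝ, 0 ≤ s → ∫ ω, Real.exp (-s * (C.inr ω + 1)) ∂P = S.delta0 s) ∧
    (∀ (n : ℕ) (s : ℝ), 0 ≤ s → iteratedDeriv n S.delta0 s = S.delta n s) ∧
    -- the SINR has the distribution determined by the law of the normalized SNR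
    (∀ x : ℝ, P.real {ω | C.sinr ω ≤ x} = C.sinrCDF (P.map C.gA2G) x) ∧
    -- closed form of that distribution for the SISR law with the same first two moments
    (∀ (I m : ℕ) (ψ : ℝ) (u : Fin I → ℂ), 1 ≤ I → 1 < ψ → (m : ℝ) = I * ψ →
      (∀ i, ‖u i‖ = 1) →
      I ≤ ⌊S.momA2G 1 ^ 2 / (S.momA2G 2 - S.momA2G 1 ^ 2)⌋₊ →
      0 < A2G.sisrSigma2 I ψ (S.momA2G 1) (S.momA2G 2) →
      let ν : Measure ℝ := A2G.sisr I ψ (A2G.sisrOmega I ψ (S.momA2G 1) (S.momA2G 2))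
        (A2G.sisrSigma2 I ψ (S.momA2G 1) (S.momA2G 2)) u
      let α : ℝ := A2G.sisrAlpha I ψ (S.momA2G 1) (S.momA2G 2)
      IsProbabilityMeasure ν ∧
      (Integrable (fun y => y) ν ∧ ∫ y, y ∂ν = ∫ ω, C.gA2G ω ∂P) ∧
      (Integrable (fun y => y ^ 2) ν ∧ ∫ y, y ^ 2 ∂ν = ∫ ω, C.gA2G ω ^ 2 ∂P) ∧
      ∀ x : ℝ, 0 < x →
        C.sinrCDF ν x = 1 - ∑ k ∈ Finset.range (m - I + 1),
          A2G.sisrChi I m ψ (S.momA2G 1) (S.momA2G 2) k *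
            ∑ n ∈ Finset.range (m - k),
              (-(x / (α * S.snrCas))) ^ n * S.delta n (x / (α * S.snrCas)) / (n ! : ℝ)) := by
  refine ⟨C.integral_gCas_rpow, C.integral_gDirN_rpow, S.blockProb_eq, C.integral_gA2G_pow,
    fun s hs => C.integral_exp_neg_inr hs, fun n s hs => S.iteratedDeriv_delta0 n hs,
    C.measureReal_sinr_le, ?_⟩
  intro I m ψ u hI hψ hm hu hfloor hs ν α
  have hμ := (Nat.le_floor_iff' (by omega)).1 hfloor
  obtain ⟨hint_id, hmean⟩ := A2G.integral_id_sisr_matched hI hψ.le hm hs hu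
  obtain ⟨hint_sq, hsecond⟩ := A2G.integral_sq_sisr_matched hI hψ hm hs hμ hu
  refine ⟨A2G.isProbabilityMeasure_sisr (by linarith) _ _ _ _, ⟨hint_id, ?_⟩, ⟨hint_sq, ?_⟩,
    fun x hx => C.sinrCDF_sisr hI hψ.le hm hs hu hx⟩
  · rw [hmean, ← (C.integral_gA2G_pow 1).2]
    simp only [pow_one]
  · rw [hsecond, (C.integral_gA2G_pow 2).2]
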